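/- Let $T>0$, $n\ge 1$, $\alpha\ge 0$, let $\Lambda\in\mathbb R^{n\times n}$ be symmetric positive definite and $\theta_1,\dots,\theta_n\ge 0$, $\theta=\sum_i\theta_i$. On a probability space let $\tilde P$ be an $\mathbb R^n$-valued square-integrable càdlàg martingale on $[0,T]$ with $\mathrm{Cov}(\tilde P_i(s),\tilde P_j(s))=s\,\Sigma_{i,j}$ for all $s\in[0,T]$, and let $\pi=(\pi_1,\dots,\pi_n)$ be independent Poisson processes with intensities $\theta_1,\dots,\theta_n$, with $\pi$ independent of $\tilde P$. Let $(\mathcal F_s)$ be the completion of the filtration $\sigma(\tilde P(r),\pi(q): 0\le r\le s,\ 0\le q<s)$. Put $D=\sqrt{\Lambda^{-1}}\,\Sigma\,\sqrt{\Lambda^{-1}}$, denote the smallest and largest eigenvalues of $\Lambda$ and $D$ by $\lambda_{\min},\lambda_{\max},d_{\min},d_{\max}$, and let $$l_0=\max\Big\{\lambda_{\max}\Big(\sqrt{\tfrac{\theta^2}{4}+\alpha d_{\min}}-\tfrac{\theta}{2}\Big),\ \lambda_{\min}\sqrt{\alpha d_{\max}}\Big\}.$$ For $t\in[0,T)$ and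 $x\in\mathbb R^n$, a pair $(\xi,\eta)$ of $\mathbb R^n$-valued processes on $[t,T)$, with $\xi$ progressively measurable and $\eta$ predictable, is called an *admissible trading strategy* if 1. the stochastic differential equation $dX(s)=-\xi(s)\,ds-\eta(s)\,d\pi(s)$, $X(t)=x$ (where the $i$-th component of $\eta\,d\pi$ is $\eta_i\,d\pi_i$) has a unique càdlàg adapted solution on $[t,T)$, up to indistinguishability; 2. $\mathbb E\big[\int_t^T\|\xi(s)\|_2^4\,ds\big]<\infty$ and $\mathbb E\big[\int_t^T\|\eta(s)\|_2^8\,ds\big]<\infty$; 3. $\eta_i(s)=0$ for all $s\in[t,T)$ whenever $\theta_i=0$. Let $l>l_0$. Then the terminal value problem $$C'=C^\top\Lambda^{-1}C+C^\top\,\mathrm{diag}\Big(\frac{\theta_i}{c_{i,i}}\Big)C-\alpha\Sigma,\qquad C(T)=l\,I,$$ has a unique solution $C(l,\cdot)=(c_{i,j}(l,\cdot))$ on $[0,T]$ (with nonvanishing diagonal entries), and for this $C$ the following holds for every $(t,x)\in[0,T)\times\mathbb R^n$. Put $\bar C(l,s)=\mathrm{diag}(1/c_{i,i}(l,s))$ and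 $\tilde I=\mathrm{diag}(\mathbf 1_{\{\theta_i>0\}})$. The closed-loop equation $$dX(s)=-\Lambda^{-1}C(l,s)X(s)\,ds-\tilde I\,\bar C(l,s)C(l,s)X(s-)\,d\pi(s),\qquad X(t)=x,$$ has a càdlàg adapted solution $X^*$ on $[t,T)$, unique up to indistinguishability, and the strategy $$u^*(l)=\big(\xi^*(s),\eta^*(s)\big)=\big(\Lambda^{-1}C(l,s)X^*(s),\ \tilde I\,\bar C(l,s)C(l,s)X^*(s-)\big),\qquad s\in[t,T)$$ (with $X^*(t-):=X^*(t)$), is an admissible trading strategy. -/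

import Mathlib

open MeasureTheory ProbabilityTheory Filter Topology Set
open scoped NNReal ENNReal MatrixOrder

noncomputable section

namespace DarkPool

/-- A path is càdlàg: right-continuous with left limits at every time. -/
def IsCadlagPath {ι E : Type*} [Preorder ι] [TopologicalSpace ι] [TopologicalSpace E]
    (f : ι → E) : Prop :=
  ∀ s, ContinuousWithinAt f (Ici s) s ∧ ∃ y, Tendsto f (𝓝[<] s) (𝓝 y)

/-- The jump `N(s) - N(s-)` of a counting path. -/
def jump (N : ℝ≥0 → ℕ) (s : ℝ≥0) : ℝ :=
  (N s : ℝ) - Function.leftLim (fun r => (N r : ℝ)) s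

/-- A Poisson process with intensity `θ ≥ 0` (for `θ = 0` it vanishes almost surely). -/
structure IsPoissonProcess {Ω : Type*} [MeasurableSpace Ω] (N : ℝ≥0 → Ω → ℕ) (θ : ℝ≥0)
    (μ : Measure Ω) : Prop where
  measurable : ∀ s, Measurable (N s)
  zero : ∀ ω, N 0 ω = 0
  monotone : ∀ ω, Monotone fun s => N s ω
  cadlag : ∀ ω, IsCadlagPath fun s => N s ω
  indepIncrements : HasIndepIncrements N μ
  law_increment : ∀ r s, r ≤ s →
    HasLaw (fun ω => N s ω - N r ω) (poissonMeasure (θ * (s - r))) μ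

/-- Smallest eigenvalue of a real symmetric matrix. -/
def eigMin {n : ℕ} (A : Matrix (Fin n) (Fin n) ℝ) : ℝ := sInf (spectrum ℝ A)

/-- Largest eigenvalue of a real symmetric matrix. -/
def eigMax {n : ℕ} (A : Matrix (Fin n) (Fin n) ℝ) : ℝ := sSup (spectrum ℝ A)

/-- Lebesgue measure `dr` on the trading period `[t, T)`. -/
def timeMeasure (t T : ℝ) : Measure (Ico t T) := Measure.comap Subtype.val volume

/-- The market: time horizon `T`, risk aversion `α`, price impact matrix `Λ`, fundamental price `P`
of the `n` assets on `[0, T]`, its covariance matrix `Sig` per unit of time, and the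
`n`-dimensional Poisson process `π` of dark pool executions with intensities `θ`. -/
structure Market (n : ℕ) {Ω : Type*} [MeasurableSpace Ω] (μ : Measure Ω) where
  T : ℝ
  T_pos : 0 < T
  α : ℝ
  α_nonneg : 0 ≤ α
  Λ : Matrix (Fin n) (Fin n) ℝ
  Λ_posDef : Λ.PosDef
  P : Icc (0 : ℝ) T → Ω → EuclideanSpace ℝ (Fin n)
  P_measurable : ∀ s, StronglyMeasurable (P s)
  P_cadlag : ∀ ω, IsCadlagPath fun s => P s ω
  P_memLp : ∀ s, MemLp (P s) 2 μ
  P_martingale : Martingale P (Filtration.natural P P_measurable) μ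
  Sig : Matrix (Fin n) (Fin n) ℝ
  P_cov : ∀ s i j, covariance (fun ω => P s ω i) (fun ω => P s ω j) μ = (s : ℝ) * Sig i j
  θ : Fin n → ℝ≥0
  π : Fin n → ℝ≥0 → Ω → ℕ
  π_poisson : ∀ i, IsPoissonProcess (π i) (θ i) μ
  π_indep : iIndepFun (fun i ω s => π i s ω) μ
  π_P_indep : IndepFun (fun ω i s => π i s ω) (fun ω s => P s ω) μ

namespace Market

variable {n : ℕ} {Ω : Type*} [m : MeasurableSpace Ω] {μ : Measure Ω}

/-- The filtration generated by `P(r)`, `r ≤ s`, and `π(r)`, `r < s`, completed by the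
null events. -/
def filtration (M : Market n μ) : Filtration ℝ m where
  seq s := (⨆ r : Icc (0 : ℝ) M.T, ⨆ _ : (r : ℝ) ≤ s, MeasurableSpace.comap (M.P r) inferInstance)
    ⊔ (⨆ i : Fin n, ⨆ r : ℝ≥0, ⨆ _ : (r : ℝ) < s, MeasurableSpace.comap (M.π i r) inferInstance)
    ⊔ MeasurableSpace.generateFrom {A | MeasurableSet[m] A ∧ μ A = 0}
  mono' := by
    intro s s' h
    refine sup_le_sup (sup_le_sup ?_ ?_) le_rfl
    · exact iSup_mono fun r => iSup_mono' fun hr => ⟨hr.trans h, le_rfl⟩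
    · exact iSup_mono fun i => iSup_mono fun r => iSup_mono' fun hr => ⟨hr.trans_le h, le_rfl⟩
  le' := by
    intro s
    refine sup_le (sup_le ?_ ?_) ?_
    · exact iSup_le fun r => iSup_le fun _ => (M.P_measurable r).measurable.comap_le
    · exact iSup_le fun i => iSup_le fun r => iSup_le fun _ =>
        ((M.π_poisson i).measurable r).comap_le
    · exact MeasurableSpace.generateFrom_le fun A hA => hA.1

/-- The filtration restricted to the trading period `[t, T)`. -/
def filtrationFrom (M : Market n μ) (t : ℝ) : Filtration (Ico t M.T) m where
  seq s := M.filtration s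
  mono' _ _ h := M.filtration.mono h
  le' s := M.filtration.le s

/-- The pathwise integral `∫_{(t,s]} η dπ`, whose `i`-th coordinate is the sum of
`η_i(r) (π_i(r) - π_i(r-))` over the (finitely many) jump times `r` of `π_i` in `(t, s]`. -/
def darkPoolIntegral (M : Market n μ) {t : ℝ} (η : Ico t M.T → Ω → EuclideanSpace ℝ (Fin n))
    (s : Ico t M.T) (ω : Ω) : EuclideanSpace ℝ (Fin n) :=
  WithLp.toLp 2 fun i =>
    ∑ᶠ r ∈ {r : Ico t M.T | t < r ∧ r ≤ s}, η r ω i * jump (fun q => M.π i q ω) (r : ℝ).toNNReal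

/-- `X` solves `dX = -ξ ds - η dπ`, `X(t) = x` on `[t, T)`: it is càdlàg, adapted and almost surely
`X(s) = x - ∫_t^s ξ(r) dr - ∫_{(t,s]} η(r) dπ(r)` for all `s`, where the first integral converges
absolutely. -/
structure IsSolution (M : Market n μ) (t : ℝ) (x : EuclideanSpace ℝ (Fin n))
    (ξ η X : Ico t M.T → Ω → EuclideanSpace ℝ (Fin n)) : Prop where
  cadlag : ∀ ω, IsCadlagPath fun s => X s ω
  adapted : StronglyAdapted (M.filtrationFrom t) X
  equation : ∀ᵐ ω ∂μ, ∀ s, IntegrableOn (fun r => ξ r ω) (Iic s) (timeMeasure t M.T) ∧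
    X s ω = x - (∫ r in Iic s, ξ r ω ∂timeMeasure t M.T) - M.darkPoolIntegral η s ω

/-- `u = (ξ, η)` is an admissible trading strategy for the initial time `t` and position `x`. -/
structure IsAdmissible (M : Market n μ) (t : ℝ) [Fact (t < M.T)] (x : EuclideanSpace ℝ (Fin n))
    (ξ η : Ico t M.T → Ω → EuclideanSpace ℝ (Fin n)) : Prop where
  progressive : IsStronglyProgressive (M.filtrationFrom t) ξ
  predictable : IsStronglyPredictable (M.filtrationFrom t) η
  exists_unique_solution : ∃ X, M.IsSolution t x ξ η X ∧
    ∀ Y, M.IsSolution t x ξ η Y → ∀ᵐ ω ∂μ, ∀ s, Y s ω = X s ω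
  moment_xi : ∫⁻ ω, (∫⁻ s, ‖ξ s ω‖ₑ ^ 4 ∂timeMeasure t M.T) ∂μ < ∞
  moment_eta : ∫⁻ ω, (∫⁻ s, ‖η s ω‖ₑ ^ 8 ∂timeMeasure t M.T) ∂μ < ∞
  eta_eq_zero : ∀ i, M.θ i = 0 → ∀ s ω, η s ω i = 0

/-- `D = √(Λ⁻¹) Sig √(Λ⁻¹)`. -/
def D (M : Market n μ) : Matrix (Fin n) (Fin n) ℝ :=
  CFC.sqrt M.Λ⁻¹ * M.Sig * CFC.sqrt M.Λ⁻¹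

/-- The total intensity `θ = θ₁ + ⋯ + θₙ`. -/
def θtot (M : Market n μ) : ℝ := ∑ i, (M.θ i : ℝ)

/-- The threshold `l₀` for the end-cost parameter. -/
def l₀ (M : Market n μ) : ℝ :=
  max (eigMax M.Λ * (√(M.θtot ^ 2 / 4 + M.α * eigMin M.D) - M.θtot / 2))
    (eigMin M.Λ * √(M.α * eigMax M.D))

/-- The right-hand side `Cᵀ Λ⁻¹ C + Cᵀ diag(θ_i / c_ii) C - α Sig`. -/
def riccatiRHS (M : Market n μ) (C : Matrix (Fin n) (Fin n) ℝ) : Matrix (Fin n) (Fin n) ℝ :=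
  C.transpose * M.Λ⁻¹ * C + C.transpose * Matrix.diagonal (fun i => (M.θ i : ℝ) / C i i) * C
    - M.α • M.Sig

/-- `C` solves `C' = Cᵀ Λ⁻¹ C + Cᵀ diag(θ_i / c_ii) C - α Sig` on `[0, T]`, `C(T) = l I`; in
particular the quotients are defined. -/
structure IsRiccatiSolution (M : Market n μ) (l : ℝ) (C : ℝ → Matrix (Fin n) (Fin n) ℝ) : Prop where
  diag_ne_zero : ∀ s ∈ Icc 0 M.T, ∀ i, C s i i ≠ 0
  deriv : ∀ s ∈ Icc 0 M.T, ∀ i j,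
    HasDerivWithinAt (fun r => C r i j) (M.riccatiRHS (C s) i j) (Icc 0 M.T) s
  terminal : C M.T = l • (1 : Matrix (Fin n) (Fin n) ℝ)

/-- The feedback function `ξ*(s, y) = Λ⁻¹ C(s) y`. -/
def feedbackXi (M : Market n μ) (C : ℝ → Matrix (Fin n) (Fin n) ℝ) (s : ℝ)
    (y : EuclideanSpace ℝ (Fin n)) : EuclideanSpace ℝ (Fin n) :=
  Matrix.toEuclideanLin (M.Λ⁻¹ * C s) y

/-- The feedback function `η*(s, y) = Ĩ C̄(s) C(s) y` with `Ĩ = diag(1_{θ_i > 0})` and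
`C̄ = diag(1 / c_ii)`. -/
def feedbackEta (M : Market n μ) (C : ℝ → Matrix (Fin n) (Fin n) ℝ) (s : ℝ)
    (y : EuclideanSpace ℝ (Fin n)) : EuclideanSpace ℝ (Fin n) :=
  Matrix.toEuclideanLin (Matrix.diagonal (fun i => if 0 < M.θ i then (1 : ℝ) else 0) *
    Matrix.diagonal (fun i => 1 / C s i i) * C s) y

/-- The process `ξ*(s, X(s))`. -/
def xiStar (M : Market n μ) (C : ℝ → Matrix (Fin n) (Fin n) ℝ) {t : ℝ}
    (X : Ico t M.T → Ω → EuclideanSpace ℝ (Fin n)) (s : Ico t M.T) (ω : Ω) :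
    EuclideanSpace ℝ (Fin n) :=
  M.feedbackXi C s (X s ω)

/-- The process `η*(s, X(s-))`; at the initial time the left limit is read as `X(t-) = X(t)`. -/
def etaStar (M : Market n μ) (C : ℝ → Matrix (Fin n) (Fin n) ℝ) {t : ℝ}
    (X : Ico t M.T → Ω → EuclideanSpace ℝ (Fin n)) (s : Ico t M.T) (ω : Ω) :
    EuclideanSpace ℝ (Fin n) :=
  M.feedbackEta C s (Function.leftLim (fun r => X r ω) s)

/-- `X` solves the closed-loop equation, in which the feedback controls are evaluated along `X`. -/
def IsClosedLoopSolution (M : Market n μ) (C : ℝ → Matrix (Fin n) (Fin n) ℝ) (t : ℝ)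
    (x : EuclideanSpace ℝ (Fin n)) (X : Ico t M.T → Ω → EuclideanSpace ℝ (Fin n)) : Prop :=
  M.IsSolution t x (M.xiStar C X) (M.etaStar C X) X

end Market

end DarkPool

end

/-!
The Riccati equation is solved backwards. With `τ = T - s` it reads
`K' = α Sig - K Λ⁻¹ K - K diag(θᵢ / kᵢᵢ) K`, `K(0) = l I`, where `l > l₀ ≥ 0`. As long as `K` is
symmetric and positive semidefinite with positive diagonal, its quadratic forms satisfy two bounds
(`riccati_apriori`). They grow at most linearly, because both quadratic terms have a sign, and they
decay at most exponentially: the Cauchy-Schwarz inequality `(K v)ᵢ² ≤ kᵢᵢ vᵀ K v` gives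
`K diag(θᵢ / kᵢᵢ) K ≤ θ K` and `K Λ⁻¹ K ≤ c K`. So `K` stays in a fixed compact set of positive
definite matrices. Truncating the field outside a slightly larger set makes it bounded and
Lipschitz; the truncated equation has a solution on `[0, T]`, and the continuation principle
`forall_mem_Icc_of_closed_of_persists` together with the a priori bounds shows that the truncation
is never active (`exists_reversed_riccati`). Any two solutions solve a common truncated equation on
the compact interval, hence coincide (`IsRiccatiSolution.eqOn`).

The closed-loop equation is linear, `dX = -A X ds - ∑ᵢ Eᵢ H X(s-) dπᵢ` with continuous `A`, `H` and
the coordinate projections `Eᵢ`, and is solved separately for each path of `π`. If `Φ' = -A Φ`,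
`Φ(t) = 1`, then `X` is a solution if and only if `X = Φ Z`, where `Z` solves the pure jump equation
`dZ = -∑ᵢ Φ⁻¹ Eᵢ H Φ Z(s-) dπᵢ`, `Z(t) = x` (`closedLoop_path_iff`, by variation of constants and
Grönwall's inequality). The Picard iteration for `Z` is stationary after as many steps as there are
executions, and induction on the number of executions gives uniqueness
(`picardIter_eq_of_le`, `IsJumpSolution.unique`).

Every Picard iterate is adapted, since the integral of a left limit against a counting path is a
limit of Riemann sums on deterministic grids (`stronglyAdapted_jumpSum_leftLim`). The filtration
contains `π(q)` only for `q < s`, but `π(s) = π(s-)` almost surely and it contains the null events,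
so `π` is adapted (`measurable_π_filtration`). Right-continuity makes `ξ*` progressive, and `η*` is a
left limit, hence predictable. Finally an execution multiplies the norm of `Z` by at most a constant
`a`, so `‖X‖`, `‖ξ*‖`, `‖η*‖` are bounded by `b a ^ N` with the total number `N` of executions, and
exponential moments of Poisson variables are finite (`lintegral_moment_lt_top`).
-/

namespace DarkPool

/-! ### Ordinary differential equations on a compact interval -/

theorem exists_solution_of_lipschitz_bounded {E : Type*} [NormedAddCommGroup E] [NormedSpace ℝ E]
    [CompleteSpace E] {f : ℝ → E → E} {K L : ℝ≥0} {a b : ℝ} (hab : a ≤ b) (x₀ : E)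
    (hK : ∀ t ∈ Icc a b, LipschitzWith K (f t)) (hc : ∀ x, ContinuousOn (f · x) (Icc a b))
    (hL : ∀ t ∈ Icc a b, ∀ x, ‖f t x‖ ≤ L) :
    ∃ y : ℝ → E, y a = x₀ ∧ ∀ t ∈ Icc a b, HasDerivWithinAt y (f t (y t)) (Icc a b) t := by
  have h : IsPicardLindelof f (⟨a, left_mem_Icc.2 hab⟩ : Icc a b) x₀ (L * (b - a).toNNReal)
      0 L K :=
    { lipschitzOnWith := fun t ht => (hK t ht).lipschitzOnWith
      continuousOn := fun x _ => hc x
      norm_le := fun t ht x _ => hL t ht x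
      mul_max_le := by
        have : 0 ≤ b - a := sub_nonneg.2 hab
        simp [this] }
  exact h.exists_eq_forall_mem_Icc_hasDerivWithinAt₀

/-- Coordinatewise truncation of a vector to the cube `[-R, R]^ι`. -/
def clampVec {ι : Type*} (R : ℝ) (y : ι → ℝ) : ι → ℝ := fun i => max (-R) (min R (y i))

theorem clampVec_eq_self {ι : Type*} {R : ℝ} {y : ι → ℝ} (h : ∀ i, |y i| ≤ R) :
    clampVec R y = y := by
  funext i
  have := abs_le.1 (h i)
  simp [clampVec, this.1, this.2]

theorem abs_clampVec_le {ι : Type*} {R : ℝ} (hR : 0 ≤ R) (y : ι → ℝ) (i : ι) :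
    |clampVec R y i| ≤ R :=
  abs_le.2 ⟨le_max_left _ _, max_le (by linarith) (min_le_left _ _)⟩

theorem abs_clampVec_le_abs {ι : Type*} {R : ℝ} (hR : 0 ≤ R) (y : ι → ℝ) (i : ι) :
    |clampVec R y i| ≤ |y i| := by
  rw [clampVec]
  rcases abs_cases (y i) with h | h <;>
  rcases max_cases (-R) (min R (y i)) with h1 | h1 <;>
  rcases min_cases R (y i) with h2 | h2 <;> rw [abs_le] <;> constructor <;> linarith

theorem abs_clampVec_sub_le {ι : Type*} (R : ℝ) (y z : ι → ℝ) (i : ι) :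
    |clampVec R y i - clampVec R z i| ≤ |y i - z i| := by
  refine (abs_max_sub_max_le_max _ _ _ _).trans ?_
  refine max_le (by simp) ((abs_min_sub_min_le_max _ _ _ _).trans (by simp))

theorem norm_clampVec_le {ι : Type*} [Fintype ι] {R : ℝ} (hR : 0 ≤ R) (y : ι → ℝ) :
    ‖clampVec R y‖ ≤ R :=
  (pi_norm_le_iff_of_nonneg hR).2 fun i => abs_clampVec_le hR y i

theorem norm_clampVec_le_norm {ι : Type*} [Fintype ι] {R : ℝ} (hR : 0 ≤ R) (y : ι → ℝ) :
    ‖clampVec R y‖ ≤ ‖y‖ :=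
  (pi_norm_le_iff_of_nonneg (norm_nonneg _)).2 fun i =>
    (abs_clampVec_le_abs hR y i).trans (norm_le_pi_norm y i)

theorem norm_clampVec_sub_le {ι : Type*} [Fintype ι] (R : ℝ) (y z : ι → ℝ) :
    ‖clampVec R y - clampVec R z‖ ≤ ‖y - z‖ :=
  (pi_norm_le_iff_of_nonneg (norm_nonneg _)).2 fun i =>
    (abs_clampVec_sub_le R y z i).trans (norm_le_pi_norm (y - z) i)

theorem hasDerivWithinAt_Ici_of_Icc {E : Type*} [NormedAddCommGroup E] [NormedSpace ℝ E]
    {f : ℝ → E} {f' : E} {a b t : ℝ} (ht : t ∈ Ico a b) (h : HasDerivWithinAt f f' (Icc a b) t) :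
    HasDerivWithinAt f f' (Ici t) t :=
  h.mono_of_mem_nhdsWithin (Icc_mem_nhdsGE_of_mem ht)

/-- A linear equation with continuous coefficients is solvable on the whole interval: the equation
with truncated right-hand side is solvable since its field is bounded, and by Grönwall's inequality
its solution does not reach the truncation level. -/
theorem exists_linear_ode_solution_pi {ι : Type*} [Fintype ι] {A : ℝ → (ι → ℝ) →L[ℝ] (ι → ℝ)}
    {a b : ℝ} (hab : a ≤ b) (hA : ContinuousOn A (Icc a b)) (x₀ : ι → ℝ) :
    ∃ y : ℝ → ι → ℝ, y a = x₀ ∧ ∀ t ∈ Icc a b, HasDerivWithinAt y (A t (y t)) (Icc a b) t := by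
  obtain ⟨M, hM⟩ := isCompact_Icc.exists_bound_of_continuousOn hA
  have hM0 : 0 ≤ M := (norm_nonneg _).trans (hM a (left_mem_Icc.2 hab))
  set R := ‖x₀‖ * Real.exp (M * (b - a)) with hR
  have hR0 : 0 ≤ R := by positivity
  obtain ⟨y, hya, hy⟩ := exists_solution_of_lipschitz_bounded (f := fun t x => A t (clampVec R x))
    (K := M.toNNReal) (L := (M * R).toNNReal) hab x₀ (fun t ht => by
      refine LipschitzWith.of_dist_le_mul fun x z => ?_
      rw [dist_eq_norm, dist_eq_norm, ← map_sub, Real.coe_toNNReal _ hM0]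
      exact ((A t).le_of_opNorm_le (hM t ht) _).trans
        (mul_le_mul_of_nonneg_left (norm_clampVec_sub_le R x z) hM0))
    (fun x => hA.clm_apply continuousOn_const) (fun t ht x => by
      rw [Real.coe_toNNReal _ (by positivity)]
      exact ((A t).le_of_opNorm_le (hM t ht) _).trans
        (mul_le_mul_of_nonneg_left (norm_clampVec_le hR0 x) hM0))
  have hbd : ∀ t ∈ Icc a b, ‖y t‖ ≤ R := by
    intro t ht
    have h := norm_le_gronwallBound_of_norm_deriv_right_le (K := M) (ε := 0) (δ := ‖x₀‖)
      (fun t ht => (hy t ht).continuousWithinAt)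
      (fun t ht => hasDerivWithinAt_Ici_of_Icc ht (hy t (Ico_subset_Icc_self ht)))
      (by rw [hya]) (fun t ht => by
        rw [add_zero]
        exact ((A t).le_of_opNorm_le (hM t (Ico_subset_Icc_self ht)) _).trans
          (mul_le_mul_of_nonneg_left (norm_clampVec_le_norm hR0 _) hM0)) t ht
    rw [gronwallBound_ε0] at h
    refine h.trans (mul_le_mul_of_nonneg_left (Real.exp_le_exp.2 ?_) (norm_nonneg _))
    exact mul_le_mul_of_nonneg_left (by linarith [ht.2]) hM0
  refine ⟨y, hya, fun t ht => ?_⟩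
  have := hy t ht
  rwa [clampVec_eq_self fun i => (norm_le_pi_norm (y t) i).trans (hbd t ht)] at this

theorem exists_linear_ode_solution {F : Type*} [NormedAddCommGroup F] [NormedSpace ℝ F]
    [FiniteDimensional ℝ F] {A : ℝ → F →L[ℝ] F} {a b : ℝ} (hab : a ≤ b)
    (hA : ContinuousOn A (Icc a b)) (x₀ : F) :
    ∃ y : ℝ → F, y a = x₀ ∧ ∀ t ∈ Icc a b, HasDerivWithinAt y (A t (y t)) (Icc a b) t := by
  let e : F ≃L[ℝ] (Fin (Module.finrank ℝ F) → ℝ) := (Module.finBasis ℝ F).equivFunL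
  obtain ⟨z, hza, hz⟩ := exists_linear_ode_solution_pi
    (A := fun t => (e : F →L[ℝ] _).comp ((A t).comp (e.symm : _ →L[ℝ] F))) hab
    (continuousOn_const.clm_comp (hA.clm_comp continuousOn_const)) (e x₀)
  refine ⟨fun t => e.symm (z t), by simp [hza], fun t ht => ?_⟩
  have := (e.symm : _ →L[ℝ] F).hasFDerivAt.comp_hasDerivWithinAt t (hz t ht)
  simpa [Function.comp_def] using this

/-- Fundamental solution `Φ` of `Φ' = -A Φ`, `Φ(a) = 1`, with its right inverse `Ψ`. -/
theorem exists_fundamental_solution {E : Type*} [NormedAddCommGroup E] [NormedSpace ℝ E]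
    [FiniteDimensional ℝ E] {A : ℝ → E →L[ℝ] E} {a b : ℝ} (hab : a ≤ b)
    (hA : ContinuousOn A (Icc a b)) :
    ∃ Φ Ψ : ℝ → E →L[ℝ] E, Φ a = 1 ∧
      (∀ t ∈ Icc a b, HasDerivWithinAt Φ (-(A t * Φ t)) (Icc a b) t) ∧
      ContinuousOn Ψ (Icc a b) ∧ ∀ t ∈ Icc a b, Φ t * Ψ t = 1 := by
  obtain ⟨Φ, hΦa, hΦ⟩ := exists_linear_ode_solution
    (A := fun t => -(ContinuousLinearMap.mul ℝ (E →L[ℝ] E) (A t))) hab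
    ((ContinuousLinearMap.continuous _).comp_continuousOn hA).neg 1
  obtain ⟨Ψ, hΨa, hΨ⟩ := exists_linear_ode_solution
    (A := fun t => (ContinuousLinearMap.mul ℝ (E →L[ℝ] E)).flip (A t)) hab
    ((ContinuousLinearMap.continuous _).comp_continuousOn hA) 1
  simp only [neg_apply, ContinuousLinearMap.mul_apply',
    ContinuousLinearMap.flip_apply] at hΦ hΨ
  refine ⟨Φ, Ψ, hΦa, hΦ, fun t ht => (hΨ t ht).continuousWithinAt, fun t ht => ?_⟩
  -- `(Ψ Φ)' = Ψ A Φ - Ψ A Φ = 0`; in finite dimension the left inverse is a right inverse.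
  have hd : ∀ t ∈ Icc a b, HasDerivWithinAt (fun t => Ψ t * Φ t) 0 (Icc a b) t := fun t ht => by
    refine ((hΨ t ht).mul (hΦ t ht)).congr_deriv ?_
    simp [mul_assoc]
  have hc := constant_of_has_deriv_right_zero (f := fun t => Ψ t * Φ t)
    (fun t ht => (hd t ht).continuousWithinAt)
    (fun t ht => hasDerivWithinAt_Ici_of_Icc ht (hd t (Ico_subset_Icc_self ht))) t ht
  simp only [hΦa, hΨa, mul_one] at hc
  have h1 : (Ψ t : E →ₗ[ℝ] E) * (Φ t : E →ₗ[ℝ] E) = 1 := by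
    ext v; exact DFunLike.congr_fun hc v
  have h2 := mul_eq_one_comm.1 h1
  ext v
  exact DFunLike.congr_fun h2 v

/-! ### Quadratic forms -/

section QuadraticForm

variable {ι : Type*} [Fintype ι]

/-- Cauchy-Schwarz inequality for the semi-inner product of a positive semidefinite matrix `K`,
applied to a unit vector and `v`. -/
theorem mulVec_sq_le_of_psd {K : Matrix ι ι ℝ} (hs : K.IsSymm)
    (hp : ∀ v, 0 ≤ v ⬝ᵥ K.mulVec v) (v : ι → ℝ) (i : ι) :
    (K.mulVec v i) ^ 2 ≤ K i i * (v ⬝ᵥ K.mulVec v) := by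
  classical
  have h : ∀ t : ℝ, 0 ≤ K i i * (t * t) + (2 * K.mulVec v i) * t + v ⬝ᵥ K.mulVec v := by
    intro t
    have h1 : v ⬝ᵥ K.mulVec (Pi.single i 1) = K.mulVec v i := by
      rw [Matrix.dotProduct_mulVec, ← Matrix.mulVec_transpose, hs.eq]
      simp
    have := hp (v + t • Pi.single i 1)
    rw [Matrix.mulVec_add, Matrix.mulVec_smul, dotProduct_add, add_dotProduct, add_dotProduct,
      dotProduct_smul, dotProduct_smul, smul_dotProduct, smul_dotProduct, h1] at this
    simp only [single_dotProduct, Matrix.mulVec_single_one, one_mul, smul_eq_mul,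
      Matrix.col_apply] at this
    linarith
  have := discrim_le_zero h
  rw [discrim] at this
  linarith

/-- The entries of a positive semidefinite matrix are bounded by the largest diagonal entry. -/
theorem abs_apply_le_of_psd {K : Matrix ι ι ℝ} (hs : K.IsSymm)
    (hp : ∀ v, 0 ≤ v ⬝ᵥ K.mulVec v) {b : ℝ} (hb : ∀ i, K i i ≤ b) (i j : ι) : |K i j| ≤ b := by
  classical
  have hd : ∀ i, 0 ≤ K i i := fun i => by simpa using hp (Pi.single i 1)
  have h := mulVec_sq_le_of_psd hs hp (Pi.single j 1) i
  simp only [single_dotProduct, Matrix.mulVec_single_one, one_mul, Matrix.col_apply] at h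
  have hb0 : 0 ≤ b := (hd i).trans (hb i)
  refine abs_le_of_sq_le_sq ?_ hb0
  nlinarith [hb i, hb j, hd i, hd j, mul_le_mul (hb i) (hb j) (hd j) hb0]

theorem abs_quadratic_le (L : Matrix ι ι ℝ) {b : ℝ} (hL : ∀ i j, |L i j| ≤ b) (w : ι → ℝ) :
    |w ⬝ᵥ L.mulVec w| ≤ (Fintype.card ι * b) * (w ⬝ᵥ w) := by
  have h1 : ∀ i j, |w i * (L i j * w j)| ≤ b * ((w i * w i + w j * w j) / 2) := by
    intro i j
    rw [show w i * (L i j * w j) = L i j * (w i * w j) by ring, abs_mul]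
    refine mul_le_mul (hL i j) ?_ (abs_nonneg _) ((abs_nonneg _).trans (hL i j))
    rw [abs_le]; constructor <;> nlinarith [sq_nonneg (w i + w j), sq_nonneg (w i - w j)]
  simp only [dotProduct, Matrix.mulVec, Finset.mul_sum]
  refine (Finset.abs_sum_le_sum_abs _ _).trans ((Finset.sum_le_sum fun i _ =>
    (Finset.abs_sum_le_sum_abs _ _).trans (Finset.sum_le_sum fun j _ => h1 i j)).trans ?_)
  have : ∀ i j : ι, b * ((w i * w i + w j * w j) / 2)
    = b / 2 * (w i * w i) + b / 2 * (w j * w j) := fun i j => by ring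
  simp only [this, Finset.sum_add_distrib, Finset.sum_const, Finset.card_univ, ← Finset.mul_sum,
    nsmul_eq_mul]
  linarith

end QuadraticForm

namespace Market

variable {n : ℕ} {Ω : Type*} [m : MeasurableSpace Ω] {μ : Measure Ω} (M : Market n μ)

/-! ### Bounds for the Riccati field -/

theorem Sig_isSymm : M.Sig.IsSymm := by
  ext i j
  have h1 := M.P_cov ⟨M.T, M.T_pos.le, le_rfl⟩ i j
  have h2 := M.P_cov ⟨M.T, M.T_pos.le, le_rfl⟩ j i
  rw [covariance_comm, h2] at h1
  exact mul_left_cancel₀ M.T_pos.ne' h1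

/-- `T vᵀ Sig v` is the variance of `∑ vᵢ Pᵢ(T)`. -/
theorem Sig_psd [IsProbabilityMeasure μ] (v : Fin n → ℝ) : 0 ≤ v ⬝ᵥ M.Sig.mulVec v := by
  let s : Icc (0 : ℝ) M.T := ⟨M.T, M.T_pos.le, le_rfl⟩
  have hm : ∀ i, MemLp (fun ω => v i * M.P s ω i) 2 μ := fun i => by
    refine MemLp.const_mul ?_ (v i)
    exact (EuclideanSpace.proj (𝕜 := ℝ) i).comp_memLp' (M.P_memLp s)
  have h : Var[fun ω => ∑ i, v i * M.P s ω i; μ] = M.T * (v ⬝ᵥ M.Sig.mulVec v) := by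
    rw [variance_fun_sum hm]
    simp only [covariance_const_mul_left, covariance_const_mul_right, M.P_cov, dotProduct,
      Matrix.mulVec, Finset.mul_sum]
    refine Finset.sum_congr rfl fun i _ => Finset.sum_congr rfl fun j _ => ?_
    simp only [s]; ring
  have h0 := variance_nonneg (fun ω => ∑ i, v i * M.P s ω i) μ
  rw [h] at h0
  exact nonneg_of_mul_nonneg_right h0 M.T_pos

theorem l₀_nonneg : 0 ≤ M.l₀ := by
  refine le_max_of_le_right (mul_nonneg (Real.sInf_nonneg fun x hx => ?_) (Real.sqrt_nonneg _))
  rw [M.Λ_posDef.1.spectrum_real_eq_range_eigenvalues] at hx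
  obtain ⟨i, rfl⟩ := hx
  exact (M.Λ_posDef.eigenvalues_pos i).le

/-- The Riccati field evaluated on the quadratic form in direction `v`. -/
theorem dotProduct_riccatiRHS_mulVec (K : Matrix (Fin n) (Fin n) ℝ) (v : Fin n → ℝ) :
    v ⬝ᵥ (M.riccatiRHS K).mulVec v = K.mulVec v ⬝ᵥ M.Λ⁻¹.mulVec (K.mulVec v)
      + (∑ i, (M.θ i : ℝ) / K i i * (K.mulVec v i) ^ 2) - M.α * (v ⬝ᵥ M.Sig.mulVec v) := by
  have h : ∀ L : Matrix (Fin n) (Fin n) ℝ, v ⬝ᵥ (K.transpose * L * K).mulVec v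
      = K.mulVec v ⬝ᵥ L.mulVec (K.mulVec v) := by
    intro L
    rw [← Matrix.mulVec_mulVec, ← Matrix.mulVec_mulVec, Matrix.dotProduct_mulVec,
      Matrix.vecMul_transpose]
  rw [riccatiRHS, Matrix.sub_mulVec, Matrix.add_mulVec, dotProduct_sub, dotProduct_add, h, h,
    Matrix.smul_mulVec, dotProduct_smul, smul_eq_mul]
  congr 2
  simp only [dotProduct, Matrix.mulVec_diagonal]
  exact Finset.sum_congr rfl fun i _ => by ring

/-- Both quadratic terms of the Riccati field are nonnegative. -/
theorem neg_riccatiRHS_le {K : Matrix (Fin n) (Fin n) ℝ}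
    (hd : ∀ i, 0 < K i i) (v : Fin n → ℝ) :
    - (v ⬝ᵥ (M.riccatiRHS K).mulVec v) ≤ M.α * (v ⬝ᵥ M.Sig.mulVec v) := by
  rw [dotProduct_riccatiRHS_mulVec]
  have h1 : 0 ≤ K.mulVec v ⬝ᵥ M.Λ⁻¹.mulVec (K.mulVec v) := by
    simpa using M.Λ_posDef.inv.posSemidef.dotProduct_mulVec_nonneg (K.mulVec v)
  have h2 : 0 ≤ ∑ i, (M.θ i : ℝ) / K i i * (K.mulVec v i) ^ 2 :=
    Finset.sum_nonneg fun i _ => mul_nonneg (div_nonneg (M.θ i).2 (hd i).le) (sq_nonneg _)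
  linarith

/-- By Cauchy-Schwarz `K diag(θᵢ / kᵢᵢ) K ≤ (∑ θᵢ) K` and `K Λ⁻¹ K ≤ ‖Λ⁻¹‖ tr(K) K`; here `‖Λ⁻¹‖`
and `tr(K)` are estimated by `n b` and `n ρ`. So the Riccati field is dominated by a multiple of
`K`. -/
theorem riccatiRHS_le [IsProbabilityMeasure μ] {K : Matrix (Fin n) (Fin n) ℝ} {b ρ : ℝ}
    (hb : ∀ i j, |M.Λ⁻¹ i j| ≤ b) (hs : K.IsSymm) (hp : ∀ v, 0 ≤ v ⬝ᵥ K.mulVec v)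
    (hd : ∀ i, 0 < K i i) (hρ : ∀ i, K i i ≤ ρ) (hb0 : 0 ≤ b) (v : Fin n → ℝ) :
    v ⬝ᵥ (M.riccatiRHS K).mulVec v ≤ ((n * b) * (n * ρ) + M.θtot) * (v ⬝ᵥ K.mulVec v) := by
  rw [dotProduct_riccatiRHS_mulVec]
  have hcs := mulVec_sq_le_of_psd hs hp v
  have hq := hp v
  have h1 : K.mulVec v ⬝ᵥ K.mulVec v ≤ (n * ρ) * (v ⬝ᵥ K.mulVec v) := by
    have : K.mulVec v ⬝ᵥ K.mulVec v ≤ ∑ _i : Fin n, ρ * (v ⬝ᵥ K.mulVec v) :=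
      Finset.sum_le_sum fun i _ => by
        rw [← sq]; exact (hcs i).trans (mul_le_mul_of_nonneg_right (hρ i) hq)
    simpa [mul_assoc] using this
  have h2 := (le_abs_self _).trans (abs_quadratic_le M.Λ⁻¹ hb (K.mulVec v))
  rw [Fintype.card_fin] at h2
  have h3 := mul_le_mul_of_nonneg_left h1 (mul_nonneg (Nat.cast_nonneg n) hb0)
  have h4 : ∑ i, (M.θ i : ℝ) / K i i * (K.mulVec v i) ^ 2 ≤ M.θtot * (v ⬝ᵥ K.mulVec v) := by
    rw [θtot, Finset.sum_mul]
    refine Finset.sum_le_sum fun i _ => ?_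
    rw [div_mul_eq_mul_div, mul_div_assoc]
    refine mul_le_mul_of_nonneg_left ?_ (M.θ i).2
    rw [div_le_iff₀ (hd i)]
    linarith [hcs i]
  have h5 := mul_nonneg M.α_nonneg (M.Sig_psd v)
  linarith

end Market

/-! ### Bounded Lipschitz functions -/

/-- A real function that is bounded and Lipschitz; such functions form an algebra. -/
def BddLip {E : Type*} [NormedAddCommGroup E] (f : E → ℝ) : Prop :=
  ∃ B L : ℝ, 0 ≤ B ∧ 0 ≤ L ∧ (∀ x, |f x| ≤ B) ∧ ∀ x y, |f x - f y| ≤ L * ‖x - y‖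

namespace BddLip

variable {E : Type*} [NormedAddCommGroup E] {f g : E → ℝ}

theorem const (c : ℝ) : BddLip fun _ : E => c :=
  ⟨|c|, 0, abs_nonneg _, le_rfl, fun _ => le_rfl, fun _ _ => by simp⟩

theorem add (hf : BddLip f) (hg : BddLip g) : BddLip fun x => f x + g x := by
  obtain ⟨B, L, hB, hL, h1, h2⟩ := hf
  obtain ⟨B', L', hB', hL', h1', h2'⟩ := hg
  refine ⟨B + B', L + L', by positivity, by positivity, fun x => (abs_add_le _ _).trans
    (add_le_add (h1 x) (h1' x)), fun x y => ?_⟩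
  rw [add_sub_add_comm, add_mul]
  exact (abs_add_le _ _).trans (add_le_add (h2 x y) (h2' x y))

theorem mul (hf : BddLip f) (hg : BddLip g) : BddLip fun x => f x * g x := by
  obtain ⟨B, L, hB, hL, h1, h2⟩ := hf
  obtain ⟨B', L', hB', hL', h1', h2'⟩ := hg
  refine ⟨B * B', B * L' + L * B', by positivity, by positivity, fun x => ?_, fun x y => ?_⟩
  · rw [abs_mul]; exact mul_le_mul (h1 x) (h1' x) (abs_nonneg _) hB
  · have e : f x * g x - f y * g y = f x * (g x - g y) + (f x - f y) * g y := by ring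
    rw [e]
    refine (abs_add_le _ _).trans ?_
    rw [abs_mul, abs_mul]
    have i1 := mul_le_mul (h1 x) (h2' x y) (abs_nonneg _) hB
    have i2 := mul_le_mul (h2 x y) (h1' y) (abs_nonneg _) (mul_nonneg hL (norm_nonneg _))
    linarith

theorem neg (hf : BddLip f) : BddLip fun x => -f x := by
  simpa using (const (-1)).mul hf

theorem sub (hf : BddLip f) (hg : BddLip g) : BddLip fun x => f x - g x := by
  simpa [sub_eq_add_neg] using hf.add hg.neg

theorem sum {κ : Type*} (s : Finset κ) {f : κ → E → ℝ} (hf : ∀ k, BddLip (f k)) :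
    BddLip fun x => ∑ k ∈ s, f k x := by
  classical
  induction s using Finset.induction_on with
  | empty => simpa using const 0
  | insert a s ha ih => simpa [Finset.sum_insert ha] using (hf a).add ih

theorem inv_max (hf : BddLip f) {ε : ℝ} (hε : 0 < ε) : BddLip fun x => (max ε (f x))⁻¹ := by
  obtain ⟨B, L, hB, hL, h1, h2⟩ := hf
  have hp : ∀ x, 0 < max ε (f x) := fun x => lt_max_of_lt_left hε
  have hi : ∀ x, (max ε (f x))⁻¹ ≤ ε⁻¹ := fun x => inv_anti₀ hε (le_max_left _ _)
  refine ⟨ε⁻¹, ε⁻¹ * ε⁻¹ * L, by positivity, by positivity, fun x => ?_, fun x y => ?_⟩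
  · rw [abs_of_pos (inv_pos.2 (hp x))]; exact hi x
  · rw [inv_sub_inv (hp x).ne' (hp y).ne', abs_div, abs_of_pos (mul_pos (hp x) (hp y)),
      div_eq_mul_inv, mul_inv, mul_comm, mul_assoc (ε⁻¹ * ε⁻¹)]
    refine mul_le_mul (mul_le_mul (hi x) (hi y) (inv_pos.2 (hp y)).le (by positivity)) ?_
      (abs_nonneg _) (by positivity)
    rw [abs_sub_comm]
    exact ((abs_max_sub_max_le_max _ _ _ _).trans (by simp)).trans (h2 x y)

/-- A matrix-valued map with bounded Lipschitz entries is bounded and Lipschitz for the sup norm. -/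
theorem exists_lipschitzWith {ι κ : Type*} [Fintype ι] [Fintype κ] {F : E → ι → κ → ℝ}
    (h : ∀ i j, BddLip fun x => F x i j) :
    ∃ K L : ℝ≥0, LipschitzWith K F ∧ ∀ x, ‖F x‖ ≤ L := by
  choose B L hB hL h1 h2 using h
  have hB' : ∀ i j, B i j ≤ ∑ i, ∑ j, B i j := fun i j =>
    (Finset.single_le_sum (f := fun j => B i j) (fun j _ => hB i j) (Finset.mem_univ j)).trans
    (Finset.single_le_sum (f := fun i => ∑ j, B i j)
      (fun i _ => Finset.sum_nonneg fun j _ => hB i j) (Finset.mem_univ i))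
  have hL' : ∀ i j, L i j ≤ ∑ i, ∑ j, L i j := fun i j =>
    (Finset.single_le_sum (f := fun j => L i j) (fun j _ => hL i j) (Finset.mem_univ j)).trans
    (Finset.single_le_sum (f := fun i => ∑ j, L i j)
      (fun i _ => Finset.sum_nonneg fun j _ => hL i j) (Finset.mem_univ i))
  have hBs : 0 ≤ ∑ i, ∑ j, B i j := Finset.sum_nonneg fun i _ => Finset.sum_nonneg fun j _ => hB i j
  have hLs : 0 ≤ ∑ i, ∑ j, L i j := Finset.sum_nonneg fun i _ => Finset.sum_nonneg fun j _ => hL i j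
  refine ⟨⟨_, hLs⟩, ⟨_, hBs⟩, LipschitzWith.of_dist_le_mul fun x y => ?_, fun x => ?_⟩
  · rw [dist_eq_norm, dist_eq_norm]
    have h0 := mul_nonneg hLs (norm_nonneg (x - y))
    refine (pi_norm_le_iff_of_nonneg h0).2 fun i => (pi_norm_le_iff_of_nonneg h0).2 fun j => ?_
    exact (h2 i j x y).trans (mul_le_mul_of_nonneg_right (hL' i j) (norm_nonneg _))
  · exact (pi_norm_le_iff_of_nonneg hBs).2 fun i => (pi_norm_le_iff_of_nonneg hBs).2 fun j =>
      (h1 i j x).trans (hB' i j)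

end BddLip

namespace Market

variable {n : ℕ} {Ω : Type*} [m : MeasurableSpace Ω] {μ : Measure Ω} (M : Market n μ)

/-! ### The Riccati equation -/

/-- The negative of the Riccati field with the entries of the argument truncated to `[-ρ, ρ]` and
the diagonal entries in the denominators replaced by at least `ε`. It drives the time-reversed
equation. -/
noncomputable def truncRiccati (ε ρ : ℝ) (K : Fin n → Fin n → ℝ) (i j : Fin n) : ℝ :=
  M.α * M.Sig i j
    - ∑ l, (∑ k, clampVec ρ (K k) i * M.Λ⁻¹ k l) * clampVec ρ (K l) j
    - ∑ k, clampVec ρ (K k) i * ((M.θ k : ℝ) * (max ε (clampVec ρ (K k) k))⁻¹) * clampVec ρ (K k) j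

theorem truncRiccati_eq {ε ρ : ℝ} {K : Fin n → Fin n → ℝ} (h1 : ∀ i j, |K i j| ≤ ρ)
    (h2 : ∀ i, ε ≤ K i i) (i j : Fin n) :
    M.truncRiccati ε ρ K i j = -M.riccatiRHS (Matrix.of K) i j := by
  simp only [truncRiccati, clampVec_eq_self (h1 _), max_eq_right (h2 _), riccatiRHS,
    Matrix.sub_apply, Matrix.add_apply, Matrix.mul_apply, Matrix.transpose_apply, Matrix.of_apply,
    Matrix.smul_apply, smul_eq_mul, Matrix.diagonal_apply, mul_ite, mul_zero,
    Finset.sum_ite_eq', Finset.mem_univ, if_true, div_eq_mul_inv]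
  ring

theorem truncRiccati_comm (ε ρ : ℝ) (K : Fin n → Fin n → ℝ) (i j : Fin n) :
    M.truncRiccati ε ρ K i j = M.truncRiccati ε ρ K j i := by
  have hΛ : ∀ k l, M.Λ⁻¹ k l = M.Λ⁻¹ l k := fun k l => by
    simpa using (M.Λ_posDef.inv.1.apply k l).symm
  rw [truncRiccati, truncRiccati, M.Sig_isSymm.apply i j]
  congr 1
  · congr 1
    simp only [Finset.sum_mul]
    rw [Finset.sum_comm]
    refine Finset.sum_congr rfl fun k _ => Finset.sum_congr rfl fun l _ => ?_
    rw [hΛ]; ring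
  · exact Finset.sum_congr rfl fun k _ => by ring

theorem exists_truncRiccati_lipschitzWith {ε ρ : ℝ} (hε : 0 < ε) (hρ : 0 ≤ ρ) :
    ∃ K L : ℝ≥0, LipschitzWith K (M.truncRiccati ε ρ) ∧ ∀ x, ‖M.truncRiccati ε ρ x‖ ≤ L := by
  have hc : ∀ i j, BddLip fun K : Fin n → Fin n → ℝ => clampVec ρ (K i) j := fun i j =>
    ⟨ρ, 1, hρ, zero_le_one, fun K => abs_clampVec_le hρ _ _, fun K K' => by
      rw [one_mul]
      refine (abs_clampVec_sub_le ρ _ _ j).trans ?_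
      exact (norm_le_pi_norm (K i - K' i) j).trans (norm_le_pi_norm (K - K') i)⟩
  refine BddLip.exists_lipschitzWith fun i j => ?_
  refine ((BddLip.const _).sub (BddLip.sum _ fun l => ?_)).sub (BddLip.sum _ fun k => ?_)
  · exact (BddLip.sum _ fun k => (hc k i).mul (BddLip.const _)).mul (hc l j)
  · exact ((hc k i).mul ((BddLip.const _).mul ((hc k k).inv_max hε))).mul (hc k j)

end Market

/-- Continuation principle: a closed property that holds at `0` and, once it has held up to time
`τ`, persists for a short time, holds on all of `[0, T]`. -/
theorem forall_mem_Icc_of_closed_of_persists {T : ℝ} {R : ℝ → Prop}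
    (hcl : IsClosed {τ | τ ∈ Icc 0 T ∧ R τ}) (h0 : R 0)
    (hstep : ∀ τ ∈ Ico 0 T, (∀ σ ∈ Icc 0 τ, R σ) → ∀ᶠ r in 𝓝[>] τ, R r) :
    ∀ τ ∈ Icc 0 T, R τ := by
  by_contra! hcon
  obtain ⟨τ₁, hτ₁, hR₁⟩ := hcon
  set B : Set ℝ := {τ | τ ∈ Icc 0 T ∧ ¬ R τ} with hB
  have hBne : B.Nonempty := ⟨τ₁, hτ₁, hR₁⟩
  have hBb : BddBelow B := ⟨0, fun x hx => hx.1.1⟩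
  set τ := sInf B with hτ
  have hτ0 : 0 ≤ τ := le_csInf hBne fun x hx => hx.1.1
  have hlt : ∀ σ ∈ Ico 0 τ, R σ := fun σ hσ => by
    by_contra h
    have : σ ∈ B := ⟨⟨hσ.1, hσ.2.le.trans ((csInf_le hBb ⟨hτ₁, hR₁⟩).trans hτ₁.2)⟩, h⟩
    exact absurd (csInf_le hBb this) (not_le.2 hσ.2)
  have hτT : τ ≤ T := (csInf_le hBb ⟨hτ₁, hR₁⟩).trans hτ₁.2
  have hRτ : R τ := by
    rcases hτ0.eq_or_lt with h | h
    · rwa [← h]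
    · have : τ ∈ closure (Ico 0 τ) := by rw [closure_Ico h.ne]; exact ⟨hτ0, le_rfl⟩
      have hsub : Ico 0 τ ⊆ {τ | τ ∈ Icc 0 T ∧ R τ} :=
        fun σ hσ => ⟨⟨hσ.1, hσ.2.le.trans hτT⟩, hlt σ hσ⟩
      exact (hcl.closure_subset_iff.2 hsub this).2
  have hle : ∀ σ ∈ Icc 0 τ, R σ := fun σ hσ => by
    rcases hσ.2.eq_or_lt with h | h
    · rwa [h]
    · exact hlt σ ⟨hσ.1, h⟩
  have hτT' : τ < T := by
    refine lt_of_le_of_ne hτT fun h => hR₁ (hle τ₁ ⟨hτ₁.1, h ▸ hτ₁.2⟩)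
  have hev := hstep τ ⟨hτ0, hτT'⟩ hle
  obtain ⟨u, hu, hu'⟩ := (mem_nhdsGT_iff_exists_Ioo_subset).1 hev
  obtain ⟨x, hxB, hxu⟩ := exists_lt_of_csInf_lt hBne (show sInf B < u from hu)
  have hτx : τ ≤ x := csInf_le hBb hxB
  rcases hτx.eq_or_lt with h | h
  · exact hxB.2 (h ▸ hRτ)
  · exact hxB.2 (hu' ⟨h, hxu⟩)

namespace Market

variable {n : ℕ} {Ω : Type*} [m : MeasurableSpace Ω] {μ : Measure Ω} (M : Market n μ)

theorem hasDerivWithinAt_dotProduct_mulVec {K : ℝ → Matrix (Fin n) (Fin n) ℝ}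
    {K' : Matrix (Fin n) (Fin n) ℝ} {s : Set ℝ} {σ : ℝ}
    (h : ∀ i j, HasDerivWithinAt (fun r => K r i j) (K' i j) s σ) (v : Fin n → ℝ) :
    HasDerivWithinAt (fun r => v ⬝ᵥ (K r).mulVec v) (v ⬝ᵥ K'.mulVec v) s σ := by
  simp only [dotProduct, Matrix.mulVec]
  exact HasDerivWithinAt.fun_sum fun i _ => HasDerivWithinAt.const_mul _
    (HasDerivWithinAt.fun_sum fun j _ => (h i j).mul_const _)

/-- A priori bounds for the time-reversed Riccati equation, as long as the solution stays positive
semidefinite with diagonal in `(0, ρ]`: quadratic forms grow at most linearly and decay at most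
exponentially. -/
theorem riccati_apriori [IsProbabilityMeasure μ] {l b ρ τ : ℝ}
    (hb : ∀ i j, |M.Λ⁻¹ i j| ≤ b) (hb0 : 0 ≤ b) {K : ℝ → Matrix (Fin n) (Fin n) ℝ}
    (hK0 : K 0 = l • 1)
    (hK : ∀ σ ∈ Icc 0 τ, ∀ i j, HasDerivWithinAt (fun r => K r i j)
      (-M.riccatiRHS (K σ) i j) (Icc 0 τ) σ)
    (hs : ∀ σ ∈ Icc 0 τ, (K σ).IsSymm) (hp : ∀ σ ∈ Icc 0 τ, ∀ v, 0 ≤ v ⬝ᵥ (K σ).mulVec v)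
    (hd : ∀ σ ∈ Icc 0 τ, ∀ i, 0 < K σ i i) (hρ : ∀ σ ∈ Icc 0 τ, ∀ i, K σ i i ≤ ρ)
    (hτ : 0 ≤ τ) (v : Fin n → ℝ) :
    v ⬝ᵥ (K τ).mulVec v ≤ l * (v ⬝ᵥ v) + M.α * (v ⬝ᵥ M.Sig.mulVec v) * τ ∧
    l * Real.exp (-(((n * b) * (n * ρ) + M.θtot) * τ)) * (v ⬝ᵥ v) ≤ v ⬝ᵥ (K τ).mulVec v := by
  set c := (n * b) * (n * ρ) + M.θtot with hc
  have hq0 : v ⬝ᵥ (K 0).mulVec v = l * (v ⬝ᵥ v) := by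
    rw [hK0, Matrix.smul_mulVec, Matrix.one_mulVec, dotProduct_smul, smul_eq_mul]
  have hq : ∀ σ ∈ Icc 0 τ, HasDerivWithinAt (fun r => v ⬝ᵥ (K r).mulVec v)
      (-(v ⬝ᵥ (M.riccatiRHS (K σ)).mulVec v)) (Icc 0 τ) σ := fun σ hσ => by
    have := hasDerivWithinAt_dotProduct_mulVec (K' := -M.riccatiRHS (K σ)) (hK σ hσ) v
    rwa [Matrix.neg_mulVec, dotProduct_neg] at this
  have hτm : τ ∈ Icc 0 τ := ⟨hτ, le_rfl⟩
  constructor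
  · refine image_le_of_deriv_right_le_deriv_boundary
      (B := fun r => l * (v ⬝ᵥ v) + M.α * (v ⬝ᵥ M.Sig.mulVec v) * r)
      (B' := fun _ => M.α * (v ⬝ᵥ M.Sig.mulVec v))
      (fun σ hσ => (hq σ hσ).continuousWithinAt)
      (fun σ hσ => hasDerivWithinAt_Ici_of_Icc hσ (hq σ (Ico_subset_Icc_self hσ)))
      (by simp [hq0]) (by fun_prop) (fun σ _ => ?_) (fun σ hσ => ?_) hτm
    · simpa using (((hasDerivAt_id σ).const_mul (M.α * (v ⬝ᵥ M.Sig.mulVec v))).const_add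
        (l * (v ⬝ᵥ v))).hasDerivWithinAt
    · exact M.neg_riccatiRHS_le (hd σ (Ico_subset_Icc_self hσ)) v
  · have hB : ∀ σ ∈ Icc 0 τ, HasDerivWithinAt (fun r => (v ⬝ᵥ (K r).mulVec v) * Real.exp (c * r))
        (-(v ⬝ᵥ (M.riccatiRHS (K σ)).mulVec v) * Real.exp (c * σ)
          + (v ⬝ᵥ (K σ).mulVec v) * (Real.exp (c * σ) * c)) (Icc 0 τ) σ := fun σ hσ => by
      refine (hq σ hσ).mul ?_
      simpa using (((hasDerivAt_id σ).const_mul c).exp).hasDerivWithinAt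
    have h := image_le_of_deriv_right_le_deriv_boundary
      (f := fun _ => l * (v ⬝ᵥ v)) (f' := fun _ => 0) continuousOn_const
      (fun σ _ => hasDerivWithinAt_const _ _ _) (by simp [hq0])
      (fun σ hσ => (hB σ hσ).continuousWithinAt)
      (fun σ hσ => hasDerivWithinAt_Ici_of_Icc hσ (hB σ (Ico_subset_Icc_self hσ)))
      (fun σ hσ => ?_) hτm
    · rw [Real.exp_neg, mul_right_comm, ← div_eq_mul_inv, div_le_iff₀ (Real.exp_pos _)]
      exact h
    · have hσ' := Ico_subset_Icc_self hσ
      have := M.riccatiRHS_le hb (hs σ hσ') (hp σ hσ') (hd σ hσ') (hρ σ hσ') hb0 v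
      rw [← hc] at this
      nlinarith [Real.exp_pos (c * σ)]

/-- The time-reversed Riccati equation is solvable: the truncated equation has a solution, and by
the a priori bounds this solution stays in the region in which the truncation is inactive. -/
theorem exists_reversed_riccati [IsProbabilityMeasure μ] {l : ℝ} (hl : 0 < l) :
    ∃ K : ℝ → Fin n → Fin n → ℝ, K 0 = l • (1 : Matrix (Fin n) (Fin n) ℝ) ∧
      (∀ τ ∈ Icc 0 M.T, ∀ i, 0 < K τ i i) ∧
      ∀ τ ∈ Icc 0 M.T, ∀ i j, HasDerivWithinAt (fun r => K r i j)
        (-M.riccatiRHS (K τ) i j) (Icc 0 M.T) τ := by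
  have hT := M.T_pos
  have hα := M.α_nonneg
  have hSig : ∀ i, 0 ≤ M.Sig i i := fun i => by
    simpa using M.Sig_psd (Pi.single i 1)
  set b : ℝ := ∑ i, ∑ j, |M.Λ⁻¹ i j| with hb_def
  have hb : ∀ i j, |M.Λ⁻¹ i j| ≤ b := fun i j =>
    (Finset.single_le_sum (f := fun j => |M.Λ⁻¹ i j|) (fun j _ => abs_nonneg _)
      (Finset.mem_univ j)).trans
    (Finset.single_le_sum (f := fun i => ∑ j, |M.Λ⁻¹ i j|)
      (fun i _ => Finset.sum_nonneg fun j _ => abs_nonneg _) (Finset.mem_univ i))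
  have hb0 : 0 ≤ b := Finset.sum_nonneg fun i _ => Finset.sum_nonneg fun j _ => abs_nonneg _
  -- The a priori upper bound is `ρ - 1`.
  set ρ : ℝ := l + M.α * (∑ i, M.Sig i i) * M.T + 1 with hρ_def
  have hsum : 0 ≤ ∑ i, M.Sig i i := Finset.sum_nonneg fun i _ => hSig i
  have hρ1 : 0 ≤ M.α * (∑ i, M.Sig i i) * M.T := by positivity
  have hρ0 : 0 ≤ ρ := by linarith
  set c : ℝ := (n * b) * (n * ρ) + M.θtot with hc_def
  have hc0 : 0 ≤ c := add_nonneg (by positivity) (Finset.sum_nonneg fun i _ => (M.θ i).2)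
  -- The a priori lower bound is `2 ε`, which leaves room for the continuation step.
  set ε : ℝ := l * Real.exp (-(c * M.T)) / 2 with hε_def
  have hε : 0 < ε := by positivity
  have hεl : ε ≤ l := by
    have : Real.exp (-(c * M.T)) ≤ 1 := Real.exp_le_one_iff.2 (by nlinarith)
    rw [hε_def]; nlinarith
  obtain ⟨k, L, hk, hL⟩ := M.exists_truncRiccati_lipschitzWith (ε := ε) (ρ := ρ) hε hρ0
  obtain ⟨K, hK0, hK⟩ := exists_solution_of_lipschitz_bounded
    (f := fun _ x => M.truncRiccati ε ρ x) hT.le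
    (l • (1 : Matrix (Fin n) (Fin n) ℝ) : Fin n → Fin n → ℝ) (fun _ _ => hk)
    (fun _ => continuousOn_const) (fun _ _ x => hL x)
  have hKe : ∀ τ ∈ Icc 0 M.T, ∀ i j, HasDerivWithinAt (fun r => K r i j)
      (M.truncRiccati ε ρ (K τ) i j) (Icc 0 M.T) τ := fun τ hτ i j =>
    (hasDerivWithinAt_pi.1 (hasDerivWithinAt_pi.1 (hK τ hτ) i)) j
  have hcont : ∀ i j, ContinuousOn (fun r => K r i j) (Icc 0 M.T) := fun i j τ hτ =>
    (hKe τ hτ i j).continuousWithinAt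
  have hsymm : ∀ τ ∈ Icc 0 M.T, ∀ i j, K τ i j = K τ j i := by
    intro τ hτ i j
    have hd : ∀ σ ∈ Icc 0 M.T, HasDerivWithinAt (fun r => K r i j - K r j i) 0 (Icc 0 M.T) σ :=
      fun σ hσ => ((hKe σ hσ i j).sub (hKe σ hσ j i)).congr_deriv
        (by rw [M.truncRiccati_comm, sub_self])
    have := constant_of_has_deriv_right_zero (fun σ hσ => (hd σ hσ).continuousWithinAt)
      (fun σ hσ => hasDerivWithinAt_Ici_of_Icc hσ (hd σ (Ico_subset_Icc_self hσ))) τ hτ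
    simp only [hK0] at this
    have h1 : (l • (1 : Matrix (Fin n) (Fin n) ℝ)) i j =
        (l • (1 : Matrix (Fin n) (Fin n) ℝ)) j i := by
      simp [Matrix.one_apply, eq_comm]
    rw [h1, sub_self] at this
    linarith
  have hquad : ∀ v, ContinuousOn (fun r => v ⬝ᵥ (Matrix.of (K r)).mulVec v) (Icc 0 M.T) := by
    intro v
    simp only [dotProduct, Matrix.mulVec, Matrix.of_apply]
    fun_prop
  have hvv : ∀ v : Fin n → ℝ, 0 ≤ v ⬝ᵥ v := fun v =>
    Finset.sum_nonneg fun i _ => mul_self_nonneg _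
  -- The region in which the truncation is inactive.
  set R : ℝ → Prop := fun τ => (∀ v, ε * (v ⬝ᵥ v) ≤ v ⬝ᵥ (Matrix.of (K τ)).mulVec v) ∧
    ∀ i j, |K τ i j| ≤ ρ with hR_def
  have hRdiag : ∀ τ, R τ → ∀ i, ε ≤ K τ i i := fun τ h i => by
    simpa using h.1 (Pi.single i 1)
  have hRderiv : ∀ τ ∈ Icc 0 M.T, R τ → ∀ i j, HasDerivWithinAt (fun r => K r i j)
      (-M.riccatiRHS (K τ) i j) (Icc 0 M.T) τ := fun τ hτ h i j => by
    have := hKe τ hτ i j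
    rwa [M.truncRiccati_eq h.2 (hRdiag τ h)] at this
  have hRall : ∀ τ ∈ Icc 0 M.T, R τ := by
    refine forall_mem_Icc_of_closed_of_persists ?_ ?_ ?_
    · have : {τ | τ ∈ Icc 0 M.T ∧ R τ} =
          (⋂ v : Fin n → ℝ, Icc 0 M.T ∩
            (fun r => v ⬝ᵥ (Matrix.of (K r)).mulVec v) ⁻¹' Ici (ε * (v ⬝ᵥ v))) ∩
          (⋂ i, ⋂ j, Icc 0 M.T ∩ (fun r => K r i j) ⁻¹' Icc (-ρ) ρ) ∩ Icc 0 M.T := by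
        ext τ
        simp only [hR_def, abs_le, Set.mem_ofPred_eq, mem_inter_iff, mem_iInter, mem_preimage,
          mem_Ici]
        constructor
        · rintro ⟨h1, h2, h3⟩
          exact ⟨⟨fun v => ⟨h1, h2 v⟩, fun i j => ⟨h1, h3 i j⟩⟩, h1⟩
        · rintro ⟨⟨h2, h3⟩, h1⟩
          exact ⟨h1, fun v => (h2 v).2, fun i j => (h3 i j).2⟩
      rw [this]
      refine ((isClosed_iInter fun v => ?_).inter (isClosed_iInter fun i =>
        isClosed_iInter fun j => ?_)).inter isClosed_Icc
      · exact (hquad v).preimage_isClosed_of_isClosed isClosed_Icc isClosed_Ici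
      · exact (hcont i j).preimage_isClosed_of_isClosed isClosed_Icc isClosed_Icc
    · refine ⟨fun v => ?_, fun i j => ?_⟩
      · have : v ⬝ᵥ (Matrix.of (K 0)).mulVec v = l * (v ⬝ᵥ v) := by
          rw [hK0]
          change v ⬝ᵥ (l • (1 : Matrix (Fin n) (Fin n) ℝ)).mulVec v = _
          rw [Matrix.smul_mulVec, Matrix.one_mulVec, dotProduct_smul, smul_eq_mul]
        rw [this]
        exact mul_le_mul_of_nonneg_right hεl (hvv v)
      · rw [hK0]
        by_cases hij : i = j
        · simp only [Matrix.smul_apply, Matrix.one_apply, hij, if_true, smul_eq_mul, mul_one,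
            abs_of_pos hl]
          linarith
        · simpa [Matrix.one_apply, hij] using hρ0
    · intro τ hτ hle
      have hsub : Icc 0 τ ⊆ Icc 0 M.T := Icc_subset_Icc_right hτ.2.le
      have hτ' := Ico_subset_Icc_self hτ
      have hap := fun v => M.riccati_apriori (l := l) (ρ := ρ) (τ := τ) hb hb0
        (K := fun r => Matrix.of (K r))
        (by simp only [hK0]; rfl) (fun σ hσ i j => (hRderiv σ (hsub hσ) (hle σ hσ) i j).mono hsub)
        (fun σ hσ => by ext i j; exact hsymm σ (hsub hσ) j i)
        (fun σ hσ v => (mul_nonneg hε.le (hvv v)).trans ((hle σ hσ).1 v))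
        (fun σ hσ i => hε.trans_le (hRdiag σ (hle σ hσ) i))
        (fun σ hσ i => (le_abs_self _).trans ((hle σ hσ).2 i i)) hτ.1 v
      have hlow : ∀ v, 2 * ε * (v ⬝ᵥ v) ≤ v ⬝ᵥ (Matrix.of (K τ)).mulVec v := fun v => by
        refine le_trans (mul_le_mul_of_nonneg_right ?_ (hvv v)) (hap v).2
        rw [hε_def, mul_div_cancel₀ _ two_ne_zero, ← hc_def]
        refine mul_le_mul_of_nonneg_left (Real.exp_le_exp.2 (neg_le_neg ?_)) hl.le
        exact mul_le_mul_of_nonneg_left hτ.2.le hc0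
      have hupd : ∀ i, Matrix.of (K τ) i i ≤ ρ - 1 := fun i => by
        have h := (hap (Pi.single i 1)).1
        simp only [single_dotProduct, Matrix.mulVec_single_one, one_mul, Matrix.col_apply,
          Pi.single_eq_same, mul_one] at h
        have h1 : M.Sig i i ≤ ∑ i, M.Sig i i :=
          Finset.single_le_sum (f := fun i => M.Sig i i) (fun i _ => hSig i) (Finset.mem_univ i)
        have h2 : M.α * M.Sig i i * τ ≤ M.α * (∑ i, M.Sig i i) * M.T :=
          mul_le_mul (mul_le_mul_of_nonneg_left h1 hα) hτ.2.le hτ.1 (by positivity)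
        linarith
      have hup : ∀ i j, |K τ i j| ≤ ρ - 1 := abs_apply_le_of_psd (K := Matrix.of (K τ))
        (by ext i j; exact hsymm τ hτ' j i)
        (fun v => (mul_nonneg hε.le (hvv v)).trans ((hle τ ⟨hτ.1, le_rfl⟩).1 v)) hupd
      -- A perturbation of the entries by `δ` changes quadratic forms by at most `n δ ≤ ε`.
      set δ : ℝ := min 1 (ε / (n + 1)) with hδ
      have hδ0 : 0 < δ := lt_min one_pos (by positivity)
      have hnδ : n * δ ≤ ε := by
        have h1 : δ * (n + 1) ≤ ε := by
          rw [← le_div_iff₀ (by positivity)]; exact min_le_right _ _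
        nlinarith
      have hev : ∀ᶠ r in 𝓝[>] τ, ∀ i j, |K r i j - K τ i j| ≤ δ := by
        rw [eventually_all]; intro i
        rw [eventually_all]; intro j
        have h1 : Tendsto (fun r => K r i j) (𝓝[>] τ) (𝓝 (K τ i j)) :=
          (hcont i j τ hτ').mono_left
            (nhdsWithin_le_iff.2 (mem_of_superset (Ioc_mem_nhdsGT hτ.2)
              fun x hx => ⟨hτ.1.trans hx.1.le, hx.2⟩))
        filter_upwards [h1.eventually (Metric.closedBall_mem_nhds _ hδ0)] with r hr
        simpa [Real.dist_eq] using hr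
      filter_upwards [hev] with r hr
      refine ⟨fun v => ?_, fun i j => ?_⟩
      · have h1 := (abs_le.1 (abs_quadratic_le (Matrix.of (K r) - Matrix.of (K τ)) hr v)).1
        rw [Matrix.sub_mulVec, dotProduct_sub, Fintype.card_fin] at h1
        have h2 := mul_le_mul_of_nonneg_right hnδ (hvv v)
        have h3 := hlow v
        linarith
      · have h1 : |K r i j| ≤ |K r i j - K τ i j| + |K τ i j| := by
          simpa using abs_add_le (K r i j - K τ i j) (K τ i j)
        have h2 : δ ≤ 1 := min_le_left _ _
        linarith [hr i j, hup i j]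
  exact ⟨K, hK0, fun τ hτ i => hε.trans_le (hRdiag τ (hRall τ hτ) i),
    fun τ hτ => hRderiv τ hτ (hRall τ hτ)⟩

/-- The Riccati equation is solvable. The solution is extended to all real times by constants, so
that it is globally continuous. -/
theorem exists_isRiccatiSolution [IsProbabilityMeasure μ] {l : ℝ} (hl : 0 < l) :
    ∃ C : ℝ → Matrix (Fin n) (Fin n) ℝ, M.IsRiccatiSolution l C ∧ Continuous C ∧
      ∀ s i, C s i i ≠ 0 := by
  obtain ⟨K, hK0, hpos, hK⟩ := M.exists_reversed_riccati hl
  have hT := M.T_pos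
  set p : ℝ → ℝ := fun s => M.T - max 0 (min M.T s) with hp
  have hpm : ∀ s, p s ∈ Icc 0 M.T := fun s =>
    ⟨sub_nonneg.2 (max_le hT.le (min_le_left _ _)), sub_le_self _ (le_max_left _ _)⟩
  have hpe : ∀ s ∈ Icc 0 M.T, p s = M.T - s := fun s hs => by
    simp [hp, hs.1, hs.2]
  have hpc : Continuous p := by fun_prop
  refine ⟨fun s => Matrix.of (K (p s)), ⟨fun s _ i => (hpos _ (hpm s) i).ne', ?_, ?_⟩, ?_,
    fun s i => (hpos _ (hpm s) i).ne'⟩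
  · intro s hs i j
    have h1 : HasDerivWithinAt (fun r => M.T - r) (-1) (Icc 0 M.T) s := by
      simpa using ((hasDerivAt_id s).const_sub M.T).hasDerivWithinAt
    have hmaps : MapsTo (fun r => M.T - r) (Icc 0 M.T) (Icc 0 M.T) := fun r hr =>
      ⟨sub_nonneg.2 hr.2, sub_le_self _ hr.1⟩
    have h2 := (hK (M.T - s) (hmaps hs) i j).comp s h1 hmaps
    have h3 : HasDerivWithinAt (fun r => K (p r) i j) (-M.riccatiRHS (K (M.T - s)) i j * -1)
        (Icc 0 M.T) s := h2.congr (fun r hr => by simp [hpe r hr]) (by simp [hpe s hs])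
    refine h3.congr_deriv ?_
    rw [hpe s hs, mul_neg_one, neg_neg]; rfl
  · have : p M.T = 0 := by rw [hpe _ ⟨hT.le, le_rfl⟩, sub_self]
    simp only [this, hK0]; rfl
  · refine continuous_matrix fun i j => ?_
    have : ContinuousOn (fun r => K r i j) (Icc 0 M.T) := fun τ hτ =>
      (hK τ hτ i j).continuousWithinAt
    exact this.comp_continuous hpc hpm

/-- A solution stays in a compact part of the domain: its diagonal entries cannot change sign and
are positive at time `T`. -/
theorem IsRiccatiSolution.exists_bounds {l : ℝ} (hl : 0 < l) {C : ℝ → Matrix (Fin n) (Fin n) ℝ}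
    (h : M.IsRiccatiSolution l C) :
    ∃ B > 0, ∀ s ∈ Icc 0 M.T, (∀ i j, |C s i j| ≤ B) ∧ ∀ i, B⁻¹ ≤ C s i i := by
  have hT := M.T_pos
  have hcont : ∀ i j, ContinuousOn (fun r => C r i j) (Icc 0 M.T) := fun i j τ hτ =>
    (h.deriv τ hτ i j).continuousWithinAt
  have hpos : ∀ s ∈ Icc 0 M.T, ∀ i, 0 < C s i i := by
    intro s hs i
    by_contra! hneg
    have hTi : 0 ≤ C M.T i i := by simp [h.terminal, hl.le]
    obtain ⟨r, hr, hr0⟩ := isPreconnected_Icc.intermediate_value hs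
      (⟨hT.le, le_rfl⟩ : M.T ∈ Icc 0 M.T) (hcont i i) ⟨hneg, hTi⟩
    exact h.diag_ne_zero r hr i hr0
  obtain ⟨B1, hB1⟩ := isCompact_Icc.exists_bound_of_continuousOn
    (f := fun r : ℝ => (fun i j => C r i j : Fin n → Fin n → ℝ))
    (continuousOn_pi.2 fun i => continuousOn_pi.2 fun j => hcont i j)
  obtain ⟨B2, hB2⟩ := isCompact_Icc.exists_bound_of_continuousOn
    (f := fun r : ℝ => (fun i => (C r i i)⁻¹ : Fin n → ℝ))
    (continuousOn_pi.2 fun i => (hcont i i).inv₀ fun s hs => h.diag_ne_zero s hs i)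
  refine ⟨max 1 (max B1 B2), by positivity, fun s hs => ⟨fun i j => ?_, fun i => ?_⟩⟩
  · refine le_trans ?_ ((hB1 s hs).trans ((le_max_left _ _).trans (le_max_right _ _)))
    exact (norm_le_pi_norm (C s i) j).trans (norm_le_pi_norm (fun i j => C s i j) i)
  · refine inv_le_of_inv_le₀ (hpos s hs i) ?_
    refine le_trans ?_ ((hB2 s hs).trans ((le_max_right _ _).trans (le_max_right _ _)))
    exact (le_abs_self _).trans (norm_le_pi_norm (fun i => (C s i i)⁻¹) i)

/-- Two solutions stay in a common compact part of the domain, where they solve the same truncated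
equation with a Lipschitz field. -/
theorem IsRiccatiSolution.eqOn {l : ℝ} (hl : 0 < l) {C C' : ℝ → Matrix (Fin n) (Fin n) ℝ}
    (h : M.IsRiccatiSolution l C) (h' : M.IsRiccatiSolution l C') : EqOn C' C (Icc 0 M.T) := by
  obtain ⟨B, hB, hC⟩ := IsRiccatiSolution.exists_bounds M hl h
  obtain ⟨B', hB', hC'⟩ := IsRiccatiSolution.exists_bounds M hl h'
  have hm : 0 < max B B' := lt_max_of_lt_left hB
  obtain ⟨k, L, hk, -⟩ := M.exists_truncRiccati_lipschitzWith (inv_pos.2 hm) hm.le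
  have key : ∀ D : ℝ → Matrix (Fin n) (Fin n) ℝ, M.IsRiccatiSolution l D →
      (∀ s ∈ Icc 0 M.T, (∀ i j, |D s i j| ≤ max B B') ∧ ∀ i, (max B B')⁻¹ ≤ D s i i) →
      ∀ s ∈ Icc 0 M.T, HasDerivWithinAt (fun r => (fun i j => D r i j : Fin n → Fin n → ℝ))
        (-M.truncRiccati (max B B')⁻¹ (max B B') (fun i j => D s i j)) (Icc 0 M.T) s := by
    intro D hD hb s hs
    refine hasDerivWithinAt_pi.2 fun i => hasDerivWithinAt_pi.2 fun j => ?_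
    refine (hD.deriv s hs i j).congr_deriv ?_
    rw [Pi.neg_apply, Pi.neg_apply, M.truncRiccati_eq (hb s hs).1 (hb s hs).2, neg_neg]
    rfl
  have k1 := key C h fun s hs => ⟨fun i j => ((hC s hs).1 i j).trans (le_max_left _ _),
    fun i => (inv_anti₀ hB (le_max_left _ _)).trans ((hC s hs).2 i)⟩
  have k2 := key C' h' fun s hs => ⟨fun i j => ((hC' s hs).1 i j).trans (le_max_right _ _),
    fun i => (inv_anti₀ hB' (le_max_right _ _)).trans ((hC' s hs).2 i)⟩
  have hI : ∀ t ∈ Ioc 0 M.T, Icc 0 M.T ∈ 𝓝[≤] t := fun t ht => Icc_mem_nhdsLE_of_mem ht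
  have := ODE_solution_unique_of_mem_Icc_left
    (v := fun _ x => -M.truncRiccati (max B B')⁻¹ (max B B') x) (s := fun _ => univ)
    (fun t _ => hk.neg.lipschitzOnWith)
    (fun s hs => (k2 s hs).continuousWithinAt)
    (fun t ht => (k2 t (Ioc_subset_Icc_self ht)).mono_of_mem_nhdsWithin (hI t ht))
    (fun _ _ => trivial)
    (fun s hs => (k1 s hs).continuousWithinAt)
    (fun t ht => (k1 t (Ioc_subset_Icc_self ht)).mono_of_mem_nhdsWithin (hI t ht))
    (fun _ _ => trivial) (by simp [h.terminal, h'.terminal])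
  exact fun s hs => this hs

end Market

/-! ### Counting paths and sums over their jumps -/

section CountingPath

variable {ι : Type*} [LinearOrder ι] [TopologicalSpace ι]

/-- `f` is an increasing right-continuous `ℕ`-valued path and `J s = f(s) - f(s-)` is its jump at
each time `s` that has predecessors. -/
structure IsCountingPath (f : ι → ℕ) (J : ι → ℝ) : Prop where
  mono : Monotone f
  right : ∀ s, ∀ᶠ r in 𝓝[≥] s, f r = f s
  left : ∀ s, ∀ᶠ r in 𝓝[<] s, (f s : ℝ) - f r = J s

/-- The sum of `J(r) g(r)` over the times `r` up to and including `s`, the initial time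
excluded. -/
noncomputable def jumpSum [OrderBot ι] {V : Type*} [AddCommGroup V] [Module ℝ V] (J : ι → ℝ)
    (g : ι → V) (s : ι) : V :=
  ∑ᶠ r ∈ Ioc ⊥ s, J r • g r

variable [OrderTopology ι] [DenselyOrdered ι]

namespace IsCountingPath

variable {f : ι → ℕ} {J : ι → ℝ} (h : IsCountingPath f J)
include h

/-- The jump at `r` is realized as the increment from some time between `q` and `r`. -/
theorem exists_left {q r : ι} (hqr : q < r) : ∃ u, q ≤ u ∧ u < r ∧ (f r : ℝ) - f u = J r := by
  have : (𝓝[<] r).NeBot := nhdsLT_neBot_of_exists_lt ⟨q, hqr⟩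
  obtain ⟨u, hu1, hu2⟩ := ((h.left r).and (Ioo_mem_nhdsLT hqr)).exists
  exact ⟨u, hu2.1.le, hu2.2, hu1⟩

theorem jump_eq_zero {q r : ι} (hqr : q < r) (hf : f q = f r) : J r = 0 := by
  obtain ⟨u, h1, h2, h3⟩ := h.exists_left hqr
  have : f u = f r := le_antisymm (h.mono h2.le) (hf ▸ h.mono h1)
  rw [← h3, this, sub_self]

theorem lt_of_jump_ne_zero {q r : ι} (hqr : q < r) (hJ : J r ≠ 0) : f q < f r :=
  lt_of_le_of_ne (h.mono hqr.le) fun he => hJ (h.jump_eq_zero hqr he)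

theorem jump_nonneg {q r : ι} (hqr : q < r) : 0 ≤ J r := by
  obtain ⟨u, -, h2, h3⟩ := h.exists_left hqr
  rw [← h3, sub_nonneg]
  exact_mod_cast h.mono h2.le

variable [OrderBot ι]

theorem finite_jumps (s : ι) : {r | r ∈ Ioc ⊥ s ∧ J r ≠ 0}.Finite := by
  refine Set.Finite.of_finite_image (f := f) ((finite_Iic (f s)).subset ?_) ?_
  · rintro _ ⟨r, hr, rfl⟩
    exact h.mono hr.1.2
  · intro r hr r' hr' he
    rcases lt_trichotomy r r' with hlt | heq | hlt
    · exact absurd he (h.lt_of_jump_ne_zero hlt hr'.2).ne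
    · exact heq
    · exact absurd he (h.lt_of_jump_ne_zero hlt hr.2).ne'

/-- The jump times in `(⊥, s]`. -/
noncomputable def jumps (s : ι) : Finset ι := (h.finite_jumps s).toFinset

theorem mem_jumps {s r : ι} : r ∈ h.jumps s ↔ r ∈ Ioc ⊥ s ∧ J r ≠ 0 := by
  simp [jumps]

theorem jumps_filter {s u : ι} (hsu : s ≤ u) : (h.jumps u).filter (· ≤ s) = h.jumps s := by
  ext r
  simp only [Finset.mem_filter, mem_jumps, mem_Ioc]
  constructor
  · rintro ⟨⟨⟨h1, -⟩, h2⟩, h3⟩; exact ⟨⟨h1, h3⟩, h2⟩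
  · rintro ⟨⟨h1, h3⟩, h2⟩; exact ⟨⟨⟨h1, h3.trans hsu⟩, h2⟩, h3⟩

section Sum

variable {V : Type*} [AddCommGroup V] [Module ℝ V] (g : ι → V)

theorem jumpSum_eq (s : ι) : jumpSum J g s = ∑ r ∈ h.jumps s, J r • g r := by
  refine finsum_mem_eq_sum_of_inter_support_eq _ ?_
  ext r
  simp only [mem_inter_iff, Function.mem_support, Finset.mem_coe, mem_jumps]
  constructor
  · rintro ⟨h1, h2⟩; exact ⟨⟨h1, fun h0 => h2 (by simp [h0])⟩, h2⟩
  · rintro ⟨⟨h1, -⟩, h2⟩; exact ⟨h1, h2⟩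

theorem jumpSum_eq_sum_ite {s u : ι} (hsu : s ≤ u) :
    jumpSum J g s = ∑ r ∈ h.jumps u, if r ≤ s then J r • g r else 0 := by
  rw [h.jumpSum_eq, ← h.jumps_filter hsu, Finset.sum_filter]

theorem jumpSum_bot : jumpSum J g ⊥ = 0 := by
  rw [h.jumpSum_eq]
  refine Finset.sum_eq_zero fun r hr => ?_
  have := (h.mem_jumps.1 hr).1
  exact absurd this.1 (not_lt.2 this.2)

theorem jumpSum_sub {s u : ι} (hsu : s ≤ u) :
    jumpSum J g u - jumpSum J g s = ∑ r ∈ (h.jumps u).filter (s < ·), J r • g r := by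
  rw [h.jumpSum_eq_sum_ite g hsu, h.jumpSum_eq, ← Finset.sum_sub_distrib, Finset.sum_filter]
  refine Finset.sum_congr rfl fun r _ => ?_
  by_cases hr : r ≤ s
  · simp [hr, not_lt.2 hr]
  · simp [hr, not_le.1 hr]

theorem jumpSum_congr {g g' : ι → V} {s : ι} (hg : ∀ r ∈ h.jumps s, g r = g' r) :
    jumpSum J g s = jumpSum J g' s := by
  rw [h.jumpSum_eq, h.jumpSum_eq]
  exact Finset.sum_congr rfl fun r hr => by rw [hg r hr]

theorem jumpSum_eq_of_eq {s u : ι} (hsu : s ≤ u) (hf : f s = f u) :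
    jumpSum J g u = jumpSum J g s := by
  rw [← sub_eq_zero, h.jumpSum_sub g hsu]
  refine Finset.sum_eq_zero fun r hr => ?_
  obtain ⟨h1, h2⟩ := Finset.mem_filter.1 hr
  have := (h.mem_jumps.1 h1).1.2
  rw [h.jump_eq_zero h2 (le_antisymm (h.mono h2.le) (hf ▸ h.mono this)), zero_smul]

theorem eventually_jumpSum_right (s : ι) : ∀ᶠ r in 𝓝[≥] s, jumpSum J g r = jumpSum J g s := by
  filter_upwards [h.right s, self_mem_nhdsWithin] with r hr hsr
  exact h.jumpSum_eq_of_eq g hsr hr.symm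

/-- Counting paths are constant on some interval to the left of `s`, so the only jump there is the
one at `s` itself. -/
theorem eventually_jumpSum_left (s : ι) :
    ∀ᶠ r in 𝓝[<] s, jumpSum J g s - jumpSum J g r = J s • g s := by
  rcases (𝓝[<] s).eq_or_neBot with hb | hb
  · simp [hb]
  have hex : ∃ q, q < s := by
    obtain ⟨q, hq⟩ := (self_mem_nhdsWithin : Iio s ∈ 𝓝[<] s) |> hb.nonempty_of_mem
    exact ⟨q, hq⟩
  obtain ⟨c, hc, hcs⟩ := (mem_nhdsLT_iff_exists_Ioo_subset' hex.choose_spec).1 (h.left s)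
  filter_upwards [Ioo_mem_nhdsLT hc] with q hq
  rw [h.jumpSum_sub g hq.2.le]
  have hzero : ∀ r, q < r → r < s → J r = 0 := fun r hqr hrs => by
    have h1 : (f s : ℝ) - f q = J s := hcs hq
    have h2 : (f s : ℝ) - f r = J s := hcs ⟨hq.1.trans hqr, hrs⟩
    refine h.jump_eq_zero hqr ?_
    have : (f q : ℝ) = f r := by linarith
    exact_mod_cast this
  rw [Finset.sum_eq_single s]
  · intro r hr hrs
    obtain ⟨h1, h2⟩ := Finset.mem_filter.1 hr
    rw [hzero r h2 (lt_of_le_of_ne (h.mem_jumps.1 h1).1.2 hrs), zero_smul]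
  · intro hs
    have : J s = 0 := by
      by_contra hJ
      exact hs (Finset.mem_filter.2 ⟨h.mem_jumps.2 ⟨⟨bot_le.trans_lt hq.2, le_rfl⟩, hJ⟩, hq.2⟩)
    rw [this, zero_smul]

end Sum

/-- A counting path is the sum of its jumps: the difference of the two sides is locally
constant. -/
theorem sum_jumps [PreconnectedSpace ι] (s : ι) : ∑ r ∈ h.jumps s, J r = (f s : ℝ) - f ⊥ := by
  have hloc : IsLocallyConstant fun s => (f s : ℝ) - jumpSum J (fun _ => (1 : ℝ)) s := by
    rw [IsLocallyConstant.iff_eventually_eq]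
    intro s
    rw [← nhdsLT_sup_nhdsGE, eventually_sup]
    constructor
    · filter_upwards [h.left s, h.eventually_jumpSum_left (fun _ => (1 : ℝ)) s] with r h1 h2
      rw [smul_eq_mul, mul_one] at h2
      linarith
    · filter_upwards [h.right s, h.eventually_jumpSum_right (fun _ => (1 : ℝ)) s] with r h1 h2
      rw [h1, h2]
  have := hloc.apply_eq_of_preconnectedSpace s ⊥
  simp only [h.jumpSum_bot, h.jumpSum_eq, smul_eq_mul, mul_one] at this
  linarith

theorem sum_jumps_filter [PreconnectedSpace ι] {s u : ι} (hsu : s ≤ u) :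
    ∑ r ∈ (h.jumps u).filter (s < ·), J r = (f u : ℝ) - f s := by
  have := h.jumpSum_sub (fun _ => (1 : ℝ)) hsu
  simp only [h.jumpSum_eq, smul_eq_mul, mul_one, h.sum_jumps] at this
  linarith

end IsCountingPath

end CountingPath

/-! ### Step functions on a grid -/

section Grid

variable {ι : Type*} [LinearOrder ι]

/-- The step process with value `u (p k)` on `(p k, p (k + 1)]`, for a grid `p 0 ≤ ⋯ ≤ p m`. -/
def stepApprox {V : Type*} [AddCommGroup V] (p : ℕ → ι) (m : ℕ) (u : ι → V) (s : ι) : V :=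
  u (p 0) + ∑ k ∈ Finset.range m, if p (k + 1) < s then u (p (k + 1)) - u (p k) else 0

/-- The step process takes at `s` the value of `u` at the last grid point before `s`. The index does
not depend on `u`. -/
theorem exists_stepApprox_eq {p : ℕ → ι} (hp : Monotone p) (m : ℕ) (s : ι) :
    ∃ k ≤ m, (∀ {V : Type*} [AddCommGroup V] (u : ι → V), stepApprox p m u s = u (p k)) ∧
      (k = 0 ∨ p k < s) ∧ (k = m ∨ s ≤ p (k + 1)) := by
  induction m with
  | zero => exact ⟨0, le_rfl, fun u => by simp [stepApprox], Or.inl rfl, Or.inl rfl⟩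
  | succ m ih =>
    obtain ⟨k, hk, h1, h2, h3⟩ := ih
    by_cases hs : p (m + 1) < s
    · have hkm : k = m := h3.resolve_right fun h =>
        absurd (hs.trans_le h) (not_lt.2 (hp (by omega)))
      refine ⟨m + 1, le_rfl, fun u => ?_, Or.inr hs, Or.inl rfl⟩
      have := h1 u
      rw [stepApprox] at this ⊢
      rw [Finset.sum_range_succ, ← add_assoc, this, if_pos hs, hkm]
      abel
    · refine ⟨k, hk.trans (Nat.le_succ m), fun u => ?_, h2, Or.inr ?_⟩
      · have := h1 u
        rw [stepApprox] at this ⊢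
        rw [Finset.sum_range_succ, ← add_assoc, this, if_neg hs, add_zero]
      · rcases h3 with rfl | h3
        · exact not_lt.1 hs
        · exact h3

end Grid

/-! ### Pure jump equations driven by counting paths -/

section TotalCount

variable {ι : Type*} [LinearOrder ι] [TopologicalSpace ι] {κ : Type*} [Fintype κ]
  {f : κ → ι → ℕ} {J : κ → ι → ℝ} (h : ∀ i, IsCountingPath (f i) (J i))
include h

theorem eq_of_sum_eq {s u : ι} (hsu : s ≤ u) (hS : ∑ i, f i s = ∑ i, f i u) (i : κ) :
    f i s = f i u :=
  (Finset.sum_eq_sum_iff_of_le fun i _ => (h i).mono hsu).1 hS i (Finset.mem_univ i)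

theorem sum_mono {s u : ι} (hsu : s ≤ u) : ∑ i, f i s ≤ ∑ i, f i u :=
  Finset.sum_le_sum fun i _ => (h i).mono hsu

end TotalCount

section JumpEquation

variable {ι : Type*} [LinearOrder ι] [TopologicalSpace ι] [OrderBot ι] [OrderTopology ι]
  [DenselyOrdered ι] {κ : Type*} [Fintype κ]
  {V : Type*} [NormedAddCommGroup V] [NormedSpace ℝ V]
  {f : κ → ι → ℕ} {J : κ → ι → ℝ} (h : ∀ i, IsCountingPath (f i) (J i))

/-- Picard iterates, started at the constant `x`, for the equation `dZ = -∑ᵢ Gᵢ(r) Z(r-) dfᵢ(r)`,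
`Z(⊥) = x`. -/
noncomputable def picardIter (J : κ → ι → ℝ) (G : κ → ι → V →L[ℝ] V) (x : V) : ℕ → ι → V
  | 0 => fun _ => x
  | k + 1 => fun s =>
    x - ∑ i, jumpSum (J i) (fun r => G i r (Function.leftLim (picardIter J G x k) r)) s

/-- `Z` solves the equation `dZ = -∑ᵢ Gᵢ(r) Z(r-) dfᵢ(r)`, `Z(⊥) = x`. -/
def IsJumpSolution (J : κ → ι → ℝ) (G : κ → ι → V →L[ℝ] V) (x : V) (Z : ι → V) : Prop :=
  ∀ s, Z s = x - ∑ i, jumpSum (J i) (fun r => G i r (Function.leftLim Z r)) s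

theorem neBot_nhdsLT_of_bot_lt {r : ι} (hr : ⊥ < r) : (𝓝[<] r).NeBot :=
  nhdsLT_neBot_of_exists_lt ⟨⊥, hr⟩

include h

theorem eventually_jumpProcess_right (x : V) (g : κ → ι → V) (s : ι) :
    ∀ᶠ r in 𝓝[≥] s, x - ∑ i, jumpSum (J i) (g i) r = x - ∑ i, jumpSum (J i) (g i) s := by
  filter_upwards [eventually_all.2 fun i => (h i).eventually_jumpSum_right (g i) s] with r hr
  rw [Finset.sum_congr rfl fun i _ => hr i]

theorem eventually_jumpProcess_left (x : V) (g : κ → ι → V) (s : ι) :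
    ∀ᶠ r in 𝓝[<] s, x - ∑ i, jumpSum (J i) (g i) r
      = x - ∑ i, jumpSum (J i) (g i) s + ∑ i, J i s • g i s := by
  filter_upwards [eventually_all.2 fun i => (h i).eventually_jumpSum_left (g i) s] with r hr
  rw [← Finset.sum_congr rfl fun i _ => hr i, Finset.sum_sub_distrib]
  abel

theorem isCadlagPath_jumpProcess (x : V) (g : κ → ι → V) :
    IsCadlagPath fun s => x - ∑ i, jumpSum (J i) (g i) s := fun s =>
  ⟨tendsto_nhds_of_eventually_eq (eventually_jumpProcess_right h x g s), _,
    tendsto_nhds_of_eventually_eq (eventually_jumpProcess_left h x g s)⟩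

theorem isCadlagPath_picardIter (G : κ → ι → V →L[ℝ] V) (x : V) (k : ℕ) :
    IsCadlagPath (picardIter J G x k) := by
  cases k with
  | zero => exact fun s => ⟨continuousWithinAt_const, x, tendsto_const_nhds⟩
  | succ k => exact isCadlagPath_jumpProcess h x _

theorem IsJumpSolution.isCadlagPath {G : κ → ι → V →L[ℝ] V} {x : V} {Z : ι → V}
    (hZ : IsJumpSolution J G x Z) : IsCadlagPath Z := by
  rw [funext hZ]
  exact isCadlagPath_jumpProcess h x _

/-- The jump part at time `s` only involves the values of the process before the last jump. -/
theorem jumpSum_leftLim_congr (G : ι → V →L[ℝ] V) {Z Z' : ι → V} (hZ : IsCadlagPath Z) {s : ι}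
    (hs : ∀ r, ∑ i, f i r < ∑ i, f i s → Z r = Z' r) (i : κ) :
    jumpSum (J i) (fun r => G r (Function.leftLim Z r)) s
      = jumpSum (J i) (fun r => G r (Function.leftLim Z' r)) s := by
  refine (h i).jumpSum_congr fun r hr => ?_
  obtain ⟨hr1, hr2⟩ := (h i).mem_jumps.1 hr
  have := neBot_nhdsLT_of_bot_lt hr1.1
  obtain ⟨y, hy⟩ := (hZ r).2
  have he : Z =ᶠ[𝓝[<] r] Z' := by
    filter_upwards [self_mem_nhdsWithin] with q hq
    refine hs q (lt_of_lt_of_le ?_ (sum_mono h hr1.2))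
    exact Finset.sum_lt_sum (fun j _ => (h j).mono hq.le)
      ⟨i, Finset.mem_univ i, (h i).lt_of_jump_ne_zero hq hr2⟩
  rw [leftLim_eq_of_tendsto hy, leftLim_eq_of_tendsto (hy.congr' he)]

/-- The `k`-th iterate agrees with the next one while at most `k` units of jump have occurred. -/
theorem picardIter_succ_eq (G : κ → ι → V →L[ℝ] V) (x : V) (k : ℕ) (s : ι)
    (hs : ∑ i, f i s ≤ ∑ i, f i ⊥ + k) : picardIter J G x (k + 1) s = picardIter J G x k s := by
  induction k generalizing s with
  | zero =>
    have hS : ∑ i, f i ⊥ = ∑ i, f i s := le_antisymm (sum_mono h bot_le) (by simpa using hs)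
    have : ∀ i, jumpSum (J i) (fun r => G i r (Function.leftLim (picardIter J G x 0) r)) s = 0 :=
      fun i => ((h i).jumpSum_eq_of_eq _ bot_le (eq_of_sum_eq h bot_le hS i)).trans
        ((h i).jumpSum_bot _)
    simp only [picardIter] at this ⊢
    simp [this]
  | succ k ih =>
    have : ∀ i, jumpSum (J i) (fun r => G i r (Function.leftLim (picardIter J G x (k + 1)) r)) s
        = jumpSum (J i) (fun r => G i r (Function.leftLim (picardIter J G x k) r)) s := fun i =>
      jumpSum_leftLim_congr h (G i) (isCadlagPath_picardIter h G x (k + 1))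
        (fun r hr => ih r (by omega)) i
    change x - _ = x - _
    exact congrArg (x - ·) (Finset.sum_congr rfl fun i _ => this i)

/-- The Picard iteration becomes stationary: each step is exact up to one more jump. -/
theorem picardIter_eq_of_le (G : κ → ι → V →L[ℝ] V) (x : V) {k k' : ℕ} (hk : k ≤ k') (s : ι)
    (hs : ∑ i, f i s ≤ ∑ i, f i ⊥ + k) : picardIter J G x k' s = picardIter J G x k s := by
  induction k', hk using Nat.le_induction with
  | base => rfl
  | succ k' hk' ih => rw [picardIter_succ_eq h G x k' s (by omega), ih]

theorem isJumpSolution_picardIter (G : κ → ι → V →L[ℝ] V) (x : V) (k : ℕ)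
    (hk : ∀ s, ∑ i, f i s ≤ ∑ i, f i ⊥ + k) : IsJumpSolution J G x (picardIter J G x k) :=
  fun s => (picardIter_succ_eq h G x k s (hk s)).symm

/-- Uniqueness, by strong induction on the total count reached at time `s`. -/
theorem IsJumpSolution.unique {G : κ → ι → V →L[ℝ] V} {x : V} {Z Z' : ι → V}
    (hZ : IsJumpSolution J G x Z) (hZ' : IsJumpSolution J G x Z') : Z = Z' := by
  have key : ∀ N s, ∑ i, f i s = N → Z s = Z' s := by
    intro N
    induction N using Nat.strong_induction_on with
    | _ N ih =>
      intro s hs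
      rw [hZ s, hZ' s, Finset.sum_congr rfl fun i _ => jumpSum_leftLim_congr h (G i)
        (hZ.isCadlagPath h) (fun r hr => ih _ (hs ▸ hr) r rfl) i]
  exact funext fun s => key _ s rfl

/-- If some jump has occurred by time `s`, there is a last one: the total count increases strictly
at this time and no path moves afterwards. -/
theorem exists_last_jump [PreconnectedSpace ι] {s : ι} (hs : ∑ i, f i ⊥ < ∑ i, f i s) :
    ∃ τ, ⊥ < τ ∧ τ ≤ s ∧ (∀ i, f i τ = f i s) ∧ ∀ q < τ, ∑ i, f i q < ∑ i, f i τ := by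
  classical
  set F : Finset ι := Finset.univ.biUnion fun i => (h i).jumps s with hF
  have hne : F.Nonempty := by
    by_contra hemp
    rw [Finset.not_nonempty_iff_eq_empty] at hemp
    refine hs.ne (Finset.sum_congr rfl fun i _ => ?_)
    have h0 : (h i).jumps s = ∅ := by
      refine Finset.subset_empty.1 (hemp ▸ ?_)
      exact Finset.subset_biUnion_of_mem (fun i => (h i).jumps s) (Finset.mem_univ i)
    have := (h i).sum_jumps s
    rw [h0, Finset.sum_empty] at this
    exact_mod_cast (sub_eq_zero.1 this.symm).symm
  obtain ⟨i, -, hi⟩ := Finset.mem_biUnion.1 (F.max'_mem hne)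
  obtain ⟨h1, h2⟩ := (h i).mem_jumps.1 hi
  refine ⟨F.max' hne, h1.1, h1.2, fun j => ?_, fun q hq => ?_⟩
  · have h0 : ((h j).jumps s).filter (F.max' hne < ·) = ∅ := by
      refine Finset.filter_eq_empty_iff.2 fun r hr => not_lt.2 (F.le_max' r ?_)
      exact Finset.mem_biUnion.2 ⟨j, Finset.mem_univ j, hr⟩
    have := (h j).sum_jumps_filter h1.2
    rw [h0, Finset.sum_empty] at this
    exact_mod_cast (sub_eq_zero.1 this.symm).symm
  · exact Finset.sum_lt_sum (fun j _ => (h j).mono hq.le)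
      ⟨i, Finset.mem_univ i, (h i).lt_of_jump_ne_zero hq h2⟩

/-- Each jump multiplies the norm by at most `1 + K` per unit of jump size. -/
theorem IsJumpSolution.norm_le [PreconnectedSpace ι] {G : κ → ι → V →L[ℝ] V} {x : V} {Z : ι → V}
    (hZ : IsJumpSolution J G x Z) {K : ℝ} (hK0 : 0 ≤ K) (hK : ∀ i s, ‖G i s‖ ≤ K) (s : ι) :
    ‖Z s‖ ≤ ‖x‖ * (1 + K) ^ (∑ i, f i s - ∑ i, f i ⊥) := by
  have key : ∀ N s, ∑ i, f i s = N → ‖Z s‖ ≤ ‖x‖ * (1 + K) ^ (∑ i, f i s - ∑ i, f i ⊥) := by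
    intro N
    induction N using Nat.strong_induction_on with
    | _ N ih =>
      intro s hs
      rcases (sum_mono h (bot_le : ⊥ ≤ s)).eq_or_lt with heq | hlt
      · have : Z s = x := by
          rw [hZ s, Finset.sum_eq_zero fun i _ => ((h i).jumpSum_eq_of_eq _ bot_le
            (eq_of_sum_eq h bot_le heq i)).trans ((h i).jumpSum_bot _), sub_zero]
        simp [this, heq]
      · obtain ⟨τ, hτ0, hτs, hτf, hτq⟩ := exists_last_jump h hlt
        have hnb := neBot_nhdsLT_of_bot_lt hτ0
        have hZτ : Z s = Z τ := by
          rw [hZ s, hZ τ, Finset.sum_congr rfl fun i _ =>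
            (h i).jumpSum_eq_of_eq _ hτs (hτf i)]
        have hS : ∑ i, f i τ = ∑ i, f i s := Finset.sum_congr rfl fun i _ => hτf i
        have hev : ∀ᶠ q in 𝓝[<] τ, Z q = Z τ + ∑ i, J i τ • G i τ (Function.leftLim Z τ) := by
          filter_upwards [eventually_jumpProcess_left h x
            (fun i r => G i r (Function.leftLim Z r)) τ] with q hq
          rw [hZ q, hZ τ, hq]
        have hlim : Function.leftLim Z τ = Z τ + ∑ i, J i τ • G i τ (Function.leftLim Z τ) :=
          leftLim_eq_of_tendsto (tendsto_nhds_of_eventually_eq hev)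
        -- A time `q` shortly before `τ` at which `Z` has already attained its left limit.
        obtain ⟨q, hq1, hq2, hq3⟩ := (hev.and ((eventually_all.2 fun i => (h i).left τ).and
          self_mem_nhdsWithin)).exists
        rw [← hlim] at hq1
        rw [← hq1] at hlim
        have hSq := hτq q hq3
        have hIH := ih _ (by omega) q rfl
        have hJs : ∑ i, J i τ = ((∑ i, f i τ - ∑ i, f i q : ℕ) : ℝ) := by
          rw [Nat.cast_sub hSq.le, Nat.cast_sum, Nat.cast_sum, ← Finset.sum_sub_distrib]
          exact Finset.sum_congr rfl fun i _ => (hq2 i).symm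
        have hn : ‖Z τ‖ ≤ ‖Z q‖ * (1 + K) ^ (∑ i, f i τ - ∑ i, f i q) := by
          have e : Z τ = Z q - ∑ i, J i τ • G i τ (Z q) := by
            rw [eq_sub_iff_add_eq]; exact hlim.symm
          have b1 : ‖∑ i, J i τ • G i τ (Z q)‖ ≤ (∑ i, J i τ) * (K * ‖Z q‖) := by
            rw [Finset.sum_mul]
            refine (norm_sum_le _ _).trans (Finset.sum_le_sum fun i _ => ?_)
            rw [norm_smul, Real.norm_of_nonneg ((h i).jump_nonneg hτ0)]
            exact mul_le_mul_of_nonneg_left ((G i τ).le_of_opNorm_le (hK i τ) _)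
              ((h i).jump_nonneg hτ0)
          have b2 : ‖Z τ‖ ≤ ‖Z q‖ + (∑ i, J i τ) * (K * ‖Z q‖) := by
            rw [e]; exact (norm_sub_le _ _).trans (add_le_add le_rfl b1)
          have b3 := one_add_mul_le_pow (a := K) (by linarith) (∑ i, f i τ - ∑ i, f i q)
          rw [hJs] at b2
          refine b2.trans ?_
          have := mul_le_mul_of_nonneg_left b3 (norm_nonneg (Z q))
          linarith
        rw [hZτ, ← hS]
        refine hn.trans ?_
        have hqb := sum_mono h (bot_le : ⊥ ≤ q)
        have e : ∑ i, f i τ - ∑ i, f i ⊥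
            = (∑ i, f i q - ∑ i, f i ⊥) + (∑ i, f i τ - ∑ i, f i q) := by omega
        rw [e, pow_add, ← mul_assoc]
        exact mul_le_mul_of_nonneg_right hIH (by positivity)
  exact key _ s rfl

end JumpEquation

/-! ### Adding a linear drift -/

section Drift

variable {t T : ℝ} {V : Type*} [NormedAddCommGroup V] [NormedSpace ℝ V]

theorem integral_timeMeasure_indicator (g : ℝ → V) (a s : Ico t T) :
    ∫ r in Iic s, (if a ≤ r then g r else 0) ∂timeMeasure t T = ∫ r in Icc (a : ℝ) s, g r := by
  rw [← integral_indicator measurableSet_Iic]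
  have e : (indicator (Iic s) fun r : Ico t T => if a ≤ r then g r else 0)
      = fun r : Ico t T => (Icc (a : ℝ) s).indicator g r := by
    funext r
    simp only [indicator_apply, mem_Iic, mem_Icc, Subtype.coe_le_coe]
    by_cases h1 : a ≤ r <;> by_cases h2 : r ≤ s <;> simp [h1, h2]
  rw [e, timeMeasure, integral_subtype_comap measurableSet_Ico,
    integral_indicator measurableSet_Icc, Measure.restrict_restrict measurableSet_Icc]
  congr 2
  exact inter_eq_left.2 fun r hr => ⟨a.2.1.trans hr.1, hr.2.trans_lt s.2.2⟩

theorem integrableOn_timeMeasure_iff {W : Type*} [NormedAddCommGroup W] {g : ℝ → W} (s : Ico t T) :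
    IntegrableOn (fun r : Ico t T => g r) (Iic s) (timeMeasure t T) ↔
      IntegrableOn g (Icc t s) := by
  have hemb := MeasurableEmbedding.subtype_coe (measurableSet_Ico (a := t) (b := T))
  rw [← integrable_indicator_iff measurableSet_Iic, ← integrable_indicator_iff measurableSet_Icc]
  have e : (indicator (Iic s) fun r : Ico t T => g r)
      = (Icc t (s : ℝ)).indicator g ∘ Subtype.val := by
    funext r
    simp only [indicator_apply, mem_Iic, mem_Icc, Function.comp, Subtype.coe_le_coe, r.2.1,
      true_and]
  rw [e, ← hemb.integrable_map_iff, timeMeasure, hemb.map_comap, Subtype.range_coe,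
    ← IntegrableOn, integrableOn_iff_integrable_of_support_subset]
  intro r hr
  have := mem_of_indicator_ne_zero hr
  exact ⟨this.1, this.2.trans_lt s.2.2⟩

theorem integrableOn_timeMeasure_ite {W : Type*} [NormedAddCommGroup W] {g : ℝ → W}
    (hg : ContinuousOn g (Icc t T)) (a s : Ico t T) :
    IntegrableOn (fun r : Ico t T => if a ≤ r then g r else 0) (Iic s) (timeMeasure t T) := by
  have e : (fun r : Ico t T => if a ≤ r then g r else 0)
      = (Ici a).indicator fun r : Ico t T => g r := by
    funext r; simp [indicator_apply]
  rw [e]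
  refine IntegrableOn.indicator ?_ measurableSet_Ici
  rw [integrableOn_timeMeasure_iff]
  exact (hg.mono (Icc_subset_Icc_right s.2.2.le)).integrableOn_Icc

/-- Fundamental theorem of calculus in the form used for a path started at time `a`. -/
theorem integral_timeMeasure_deriv [CompleteSpace V] {φ φ' : ℝ → V}
    (hφ : ∀ r ∈ Icc t T, HasDerivWithinAt φ (φ' r) (Icc t T) r) (hφ' : ContinuousOn φ' (Icc t T))
    {a s : Ico t T} (has : a ≤ s) :
    ∫ r in Iic s, (if a ≤ r then φ' r else 0) ∂timeMeasure t T = φ s - φ a := by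
  have has' : (a : ℝ) ≤ s := has
  have hsub : Icc (a : ℝ) s ⊆ Icc t T := Icc_subset_Icc a.2.1 s.2.2.le
  rw [integral_timeMeasure_indicator, integral_Icc_eq_integral_Ioc,
    ← intervalIntegral.integral_of_le has']
  refine intervalIntegral.integral_eq_sub_of_hasDeriv_right
    (f := φ) (f' := φ') ?_ (fun r hr => ?_) ?_
  · rw [uIcc_of_le has']
    exact fun r hr => ((hφ r (hsub hr)).continuousWithinAt).mono hsub
  · rw [min_eq_left has', max_eq_right has'] at hr
    have hr' : r ∈ Ico t T := ⟨a.2.1.trans hr.1.le, hr.2.trans s.2.2⟩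
    exact (hasDerivWithinAt_Ici_of_Icc hr' (hφ r (Ico_subset_Icc_self hr'))).mono
      Ioi_subset_Ici_self
  · refine ContinuousOn.intervalIntegrable ?_
    rw [uIcc_of_le has']
    exact hφ'.mono hsub

variable [Fact (t < T)] {κ : Type*} [Fintype κ] {f : κ → Ico t T → ℕ} {J : κ → Ico t T → ℝ}

/-- Variation of constants: if `Φ' = -A Φ` with right inverse `Ψ` and `Z` jumps by `-Ψ(r) gᵢ(r)` at
the jumps of `fᵢ`, then `X = Φ Z` solves `dX = -A X dr - ∑ᵢ gᵢ dfᵢ`. -/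
theorem variation_of_constants [CompleteSpace V] (h : ∀ i, IsCountingPath (f i) (J i))
    {A Φ Ψ : ℝ → V →L[ℝ] V} (hA : ContinuousOn A (Icc t T))
    (hΦt : Φ t = 1) (hΦ : ∀ r ∈ Icc t T, HasDerivWithinAt Φ (-(A r * Φ r)) (Icc t T) r)
    (hΨ : ∀ r ∈ Icc t T, Φ r * Ψ r = 1) (x : V) (g : κ → Ico t T → V) {X : Ico t T → V}
    (hX : ∀ s, X s = Φ s (x - ∑ i, jumpSum (J i) (fun r => Ψ r (g i r)) s)) (s : Ico t T) :
    IntegrableOn (fun r : Ico t T => A r (X r)) (Iic s) (timeMeasure t T) ∧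
    X s = x - (∫ r in Iic s, A r (X r) ∂timeMeasure t T) - ∑ i, jumpSum (J i) (g i) s := by
  have hΦc : ContinuousOn Φ (Icc t T) := fun r hr => (hΦ r hr).continuousWithinAt
  have hc : ∀ v, ContinuousOn (fun r => -(A r * Φ r) v) (Icc t T) := fun v =>
    ((hA.mul hΦc).clm_apply continuousOn_const).neg
  have hd : ∀ v, ∀ r ∈ Icc t T, HasDerivWithinAt (fun r => Φ r v) (-(A r * Φ r) v) (Icc t T) r :=
    fun v r hr => by simpa using (hΦ r hr).clm_apply (hasDerivWithinAt_const r _ v)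
  -- Up to time `s` the integrand is a finite sum of smooth paths started at the jump times.
  have hAX : ∀ r ∈ Iic s, A r (X r) = -((if ⊥ ≤ r then -(A r * Φ r) x else 0)
      - ∑ i, ∑ τ ∈ (h i).jumps s, J i τ • if τ ≤ r then -(A r * Φ r) (Ψ τ (g i τ)) else 0) := by
    intro r hr
    rw [hX, if_pos bot_le]
    simp only [(h _).jumpSum_eq_sum_ite _ hr, map_sub, map_sum]
    have : ∀ i, ∀ τ, A r (Φ r (if τ ≤ r then J i τ • Ψ τ (g i τ) else 0))
        = -(J i τ • if τ ≤ r then -(A r * Φ r) (Ψ τ (g i τ)) else 0) := by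
      intro i τ
      by_cases hτ : τ ≤ r <;> simp [hτ]
    simp only [this, Finset.sum_neg_distrib]
    simp only [mul_apply_eq_comp]
    abel
  have hi1 := integrableOn_timeMeasure_ite (hc x) ⊥ s
  have hi2 : ∀ i, ∀ τ ∈ (h i).jumps s, IntegrableOn (fun r : Ico t T => J i τ •
      if τ ≤ r then -(A r * Φ r) (Ψ τ (g i τ)) else 0) (Iic s) (timeMeasure t T) := fun i τ _ =>
    (integrableOn_timeMeasure_ite (hc (Ψ τ (g i τ))) τ s).smul (J i τ)
  have hi3 : ∀ i ∈ Finset.univ, IntegrableOn (fun r : Ico t T => ∑ τ ∈ (h i).jumps s, J i τ •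
      if τ ≤ r then -(A r * Φ r) (Ψ τ (g i τ)) else 0) (Iic s) (timeMeasure t T) := fun i _ =>
    integrable_finsetSum _ (hi2 i)
  have hi4 := integrable_finsetSum _ hi3
  refine ⟨(integrableOn_congr_fun hAX measurableSet_Iic).2 (hi1.sub hi4).neg, ?_⟩
  rw [setIntegral_congr_fun measurableSet_Iic hAX, integral_neg, integral_sub hi1 hi4,
    integral_finsetSum _ hi3, Finset.sum_congr rfl fun i _ => integral_finsetSum _ (hi2 i)]
  have hint : ∀ i, ∀ τ ∈ (h i).jumps s, ∫ r in Iic s, (J i τ •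
      if τ ≤ r then -(A r * Φ r) (Ψ τ (g i τ)) else 0) ∂timeMeasure t T
      = Φ s (J i τ • Ψ τ (g i τ)) - J i τ • g i τ := by
    intro i τ hτ
    have hτs := ((h i).mem_jumps.1 hτ).1.2
    rw [integral_smul, integral_timeMeasure_deriv (hd _) (hc _) hτs, smul_sub, map_smul]
    congr 2
    exact DFunLike.congr_fun (hΨ τ (Ico_subset_Icc_self τ.2)) (g i τ)
  rw [integral_timeMeasure_deriv (hd x) (hc x) bot_le,
    Finset.sum_congr rfl fun i _ => Finset.sum_congr rfl (hint i), hX]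
  have hbot : ((⊥ : Ico t T) : ℝ) = t := rfl
  simp only [hbot, hΦt, (h _).jumpSum_eq, map_sub, map_sum, Finset.sum_sub_distrib,
    one_apply_eq_self]
  abel

/-- A solution of a homogeneous linear integral equation vanishes. This applies to the difference of
two paths with the same jump part; no continuity of `D` is presupposed. -/
theorem eq_zero_of_integral_equation [CompleteSpace V] {A : ℝ → V →L[ℝ] V}
    (hA : ContinuousOn A (Icc t T)) {D : Ico t T → V}
    (hi : ∀ s, IntegrableOn (fun r : Ico t T => A r (D r)) (Iic s) (timeMeasure t T))
    (hD : ∀ s, D s = -∫ r in Iic s, A r (D r) ∂timeMeasure t T) (s : Ico t T) : D s = 0 := by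
  classical
  set a : ℝ → V := fun r => if hr : r ∈ Ico t T then A r (D ⟨r, hr⟩) else 0 with ha
  have ha' : ∀ r : Ico t T, a r = A r (D r) := fun r => by simp [ha, r.2.1, r.2.2]
  have hai : ∀ s : Ico t T, IntegrableOn a (Icc t s) := fun s => by
    rw [← integrableOn_timeMeasure_iff]
    simpa only [ha'] using hi s
  set d : ℝ → V := fun r => -∫ u in t..r, a u with hd
  have hdD : ∀ r : Ico t T, d r = D r := fun r => by
    have := integral_timeMeasure_indicator a ⊥ r
    simp only [bot_le, if_true, ha'] at this
    rw [hD r, this, hd]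
    simp only [intervalIntegral.integral_of_le r.2.1, integral_Icc_eq_integral_Ioc]
    rfl
  have hsub : Icc t (s : ℝ) ⊆ Icc t T := Icc_subset_Icc_right s.2.2.le
  have hmem : ∀ r ∈ Icc t (s : ℝ), r ∈ Ico t T := fun r hr => ⟨hr.1, hr.2.trans_lt s.2.2⟩
  have hdc : ContinuousOn d (Icc t s) := by
    have := intervalIntegral.continuousOn_primitive_interval (a := t) (b := s) (f := a)
      (μ := volume) (by rw [uIcc_of_le s.2.1]; exact hai s)
    rw [uIcc_of_le s.2.1] at this
    exact this.neg
  have hae : ∀ r ∈ Icc t (s : ℝ), a r = A r (d r) := fun r hr => by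
    rw [ha' ⟨r, hmem r hr⟩, ← hdD ⟨r, hmem r hr⟩]
  have hac : ContinuousOn a (Icc t s) :=
    ((hA.mono hsub).clm_apply hdc).congr hae
  have hder : ∀ r ∈ Ico t (s : ℝ), HasDerivWithinAt d (-a r) (Ici r) r := fun r hr => by
    have hr' := Ico_subset_Icc_self hr
    refine HasDerivWithinAt.neg ?_
    refine intervalIntegral.integral_hasDerivWithinAt_right (t := Ioi r) (s := Ici r) ?_ ?_ ?_
    · refine ContinuousOn.intervalIntegrable (hac.mono ?_)
      rw [uIcc_of_le hr.1]; exact Icc_subset_Icc_right hr.2.le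
    · refine ⟨Icc t s, Icc_mem_nhdsGT_of_mem hr, ?_⟩
      exact hac.aestronglyMeasurable measurableSet_Icc
    · exact (hac r hr').mono_of_mem_nhdsWithin (Icc_mem_nhdsGT_of_mem hr)
  obtain ⟨M, hM⟩ := isCompact_Icc.exists_bound_of_continuousOn (hA.mono hsub)
  have := eq_zero_of_abs_deriv_le_mul_abs_self_of_eq_zero_right (K := M) hdc hder
    (by simp [hd]) (fun r hr => by
      rw [norm_neg, hae r (Ico_subset_Icc_self hr)]
      exact (A r).le_of_opNorm_le (hM r (Ico_subset_Icc_self hr)) _) s ⟨s.2.1, le_rfl⟩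
  rwa [hdD] at this

end Drift

/-! ### Measurability of left limits, jump sums and right-continuous processes -/

section GridLimits

variable {t T : ℝ} [Fact (t < T)]

/-- The equidistant grid with mesh `(T - t) / (m + 1)` in `[t, T)`, constant from index `m` on. -/
noncomputable def leftGrid (m k : ℕ) : Ico t T :=
  ⟨t + (T - t) * ((min k m : ℕ) / (m + 1)), by
    have htT : 0 < T - t := sub_pos.2 Fact.out
    have h1 : ((min k m : ℕ) : ℝ) ≤ m := by exact_mod_cast min_le_right k m
    have h2 : ((min k m : ℕ) : ℝ) / (m + 1) < 1 := by
      rw [div_lt_one (by positivity)]; linarith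
    constructor
    · have : 0 ≤ (T - t) * ((min k m : ℕ) / (m + 1)) := by positivity
      linarith
    · nlinarith⟩

theorem leftGrid_mono (m : ℕ) : Monotone (leftGrid m : ℕ → Ico t T) := by
  intro k k' hk
  have htT : 0 < T - t := sub_pos.2 Fact.out
  rw [← Subtype.coe_le_coe]
  have : ((min k m : ℕ) : ℝ) ≤ (min k' m : ℕ) := by exact_mod_cast min_le_min hk le_rfl
  simp only [leftGrid]
  gcongr

theorem leftGrid_zero (m : ℕ) : (leftGrid m 0 : Ico t T) = ⊥ := by
  rw [← Subtype.coe_inj]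
  simp only [leftGrid, Nat.zero_min, Nat.cast_zero, zero_div, mul_zero, add_zero]
  rfl

theorem tendsto_mesh (c : ℝ) : Tendsto (fun m : ℕ => c / ((m : ℝ) + 1)) atTop (𝓝 0) :=
  tendsto_const_nhds.div_atTop (tendsto_natCast_atTop_atTop.atTop_add tendsto_const_nhds)

/-- Step approximations converge to the left limit; at the initial time both are the initial
value. -/
theorem tendsto_stepApprox {V : Type*} [NormedAddCommGroup V] {u : Ico t T → V} (s : Ico t T)
    (hu : ∃ y, Tendsto u (𝓝[<] s) (𝓝 y)) :
    Tendsto (fun m => stepApprox (leftGrid m) m u s) atTop (𝓝 (Function.leftLim u s)) := by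
  have htT : 0 < T - t := sub_pos.2 Fact.out
  choose k hkm hk h0 h1 using fun m => exists_stepApprox_eq (leftGrid_mono (t := t) (T := T) m) m s
  have hval : ∀ m, stepApprox (leftGrid m) m u s = u (leftGrid m (k m)) := fun m => hk m u
  simp only [hval]
  rcases (bot_le : ⊥ ≤ s).eq_or_lt with hs | hs
  · rw [leftLim_eq_of_isBot (fun r => hs ▸ bot_le)]
    refine tendsto_const_nhds.congr fun m => ?_
    rcases h0 m with h | h
    · rw [h, leftGrid_zero, hs]
    · exact absurd h (hs ▸ not_lt_bot)
  refine (tendsto_leftLim_of_tendsto hu).comp (tendsto_nhdsWithin_iff.2 ⟨?_, ?_⟩)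
  · rw [tendsto_subtype_rng]
    refine tendsto_of_tendsto_of_tendsto_of_le_of_le (g := fun m : ℕ => (s : ℝ) - (T - t) / (m + 1))
      (by simpa using (tendsto_const_nhds (x := (s : ℝ))).sub (tendsto_mesh (T - t)))
      tendsto_const_nhds (fun m => ?_) (fun m => ?_)
    · have hgk : ((leftGrid m (k m) : Ico t T) : ℝ) = t + (T - t) * (k m / (m + 1)) := by
        simp [leftGrid, min_eq_left (hkm m)]
      have hm : (0 : ℝ) < m + 1 := by positivity
      simp only [hgk]
      by_cases hkm' : k m = m
      · have : (T - t) * ((k m : ℝ) / (m + 1)) = (T - t) - (T - t) / (m + 1) := by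
          rw [hkm']; field_simp; ring
        linarith [s.2.2]
      · have h2 : (s : ℝ) ≤ (leftGrid m (k m + 1) : Ico t T) := (h1 m).resolve_left hkm'
        have h3 : ((leftGrid m (k m + 1) : Ico t T) : ℝ)
            = t + (T - t) * (k m / (m + 1)) + (T - t) / (m + 1) := by
          have : min (k m + 1) m = k m + 1 := min_eq_left (by have := hkm m; omega)
          simp only [leftGrid, this]
          push_cast
          field_simp
          ring
        linarith
    · rcases h0 m with h | h
      · rw [h, leftGrid_zero]; exact hs.le
      · exact h.le
  · refine Eventually.of_forall fun m => ?_
    rcases h0 m with h | h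
    · rw [h, leftGrid_zero]; exact hs
    · exact h

end GridLimits

section RightGridLimits

variable {t T : ℝ}

/-- The descending equidistant grid of `[t, i]` with mesh `(i - t) / (m + 1)`. -/
noncomputable def rightGrid (i : Ico t T) (m k : ℕ) : Ico t T :=
  ⟨i - (i - t) * ((min k (m + 1) : ℕ) / (m + 1)), by
    have hi : 0 ≤ (i : ℝ) - t := sub_nonneg.2 i.2.1
    have h1 : ((min k (m + 1) : ℕ) : ℝ) ≤ m + 1 := by exact_mod_cast min_le_right k (m + 1)
    have h2 : ((min k (m + 1) : ℕ) : ℝ) / (m + 1) ≤ 1 := by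
      rw [div_le_one (by positivity)]; linarith
    constructor
    · nlinarith
    · have : 0 ≤ ((i : ℝ) - t) * ((min k (m + 1) : ℕ) / (m + 1)) := by positivity
      linarith [i.2.2]⟩

theorem rightGrid_anti (i : Ico t T) (m : ℕ) : Antitone (rightGrid i m) := by
  intro k k' hk
  have hi : 0 ≤ (i : ℝ) - t := sub_nonneg.2 i.2.1
  rw [← Subtype.coe_le_coe]
  have : ((min k (m + 1) : ℕ) : ℝ) ≤ (min k' (m + 1) : ℕ) := by exact_mod_cast min_le_min hk le_rfl
  simp only [rightGrid]
  gcongr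

theorem rightGrid_zero (i : Ico t T) (m : ℕ) : rightGrid i m 0 = i := by
  rw [← Subtype.coe_inj]
  simp [rightGrid]

theorem rightGrid_le (i : Ico t T) (m k : ℕ) : rightGrid i m k ≤ i := by
  simpa [rightGrid_zero] using rightGrid_anti i m (Nat.zero_le k)

/-- The step process on `[t, i]` taking at `r` the value of `u` at the next point of the descending
grid strictly to the right of `r`, and `u i` at `r = i`. -/
noncomputable def stepApproxRight {V : Type*} [AddCommGroup V] (i : Ico t T) (m : ℕ)
    (u : Ico t T → V) (r : Ico t T) : V :=
  u i + ∑ k ∈ Finset.range (m + 1),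
    if r < rightGrid i m (k + 1) then u (rightGrid i m (k + 1)) - u (rightGrid i m k) else 0

theorem tendsto_stepApproxRight {V : Type*} [NormedAddCommGroup V] {u : Ico t T → V}
    {i r : Ico t T} (hr : r ≤ i) (hu : ContinuousWithinAt u (Ici r) r) :
    Tendsto (fun m => stepApproxRight i m u r) atTop (𝓝 (u r)) := by
  have hi : 0 ≤ (i : ℝ) - t := sub_nonneg.2 i.2.1
  -- With the order reversed, this is the step process of `stepApprox` for an increasing grid.
  choose k hkm hk h0 h1 using fun m => exists_stepApprox_eq (ι := (Ico t T)ᵒᵈ)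
    (p := fun k => OrderDual.toDual (rightGrid i m k)) (fun a b hab => rightGrid_anti i m hab)
    (m + 1) (OrderDual.toDual r)
  have hval : ∀ m, stepApproxRight i m u r = u (rightGrid i m (k m)) := fun m => by
    refine Eq.trans ?_ (hk m (fun r => u (OrderDual.ofDual r)))
    rw [stepApprox, stepApproxRight]
    simp only [OrderDual.ofDual_toDual, rightGrid_zero, OrderDual.toDual_lt_toDual]
  simp only [OrderDual.toDual_lt_toDual, OrderDual.toDual_le_toDual] at h0 h1
  have hge : ∀ m, r ≤ rightGrid i m (k m) := fun m => by
    rcases h0 m with h | h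
    · rwa [h, rightGrid_zero]
    · exact h.le
  simp only [hval]
  refine hu.tendsto.comp (tendsto_nhdsWithin_iff.2 ⟨?_, Eventually.of_forall hge⟩)
  rw [tendsto_subtype_rng]
  refine tendsto_of_tendsto_of_tendsto_of_le_of_le (h := fun m : ℕ => (r : ℝ) + (i - t) / (m + 1))
    tendsto_const_nhds
    (by simpa using (tendsto_const_nhds (x := (r : ℝ))).add (tendsto_mesh (i - t)))
    (fun m => hge m) (fun m => ?_)
  have hm : (0 : ℝ) < m + 1 := by positivity
  have hgk : ((rightGrid i m (k m) : Ico t T) : ℝ) = i - (i - t) * (k m / (m + 1)) := by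
    simp [rightGrid, min_eq_left (hkm m)]
  simp only [hgk]
  by_cases hkm' : k m = m + 1
  · have h2 : (i - t) * ((k m : ℝ) / (m + 1)) = i - t := by
      rw [hkm']; push_cast; field_simp
    have h3 : 0 ≤ ((i : ℝ) - t) / (m + 1) := by positivity
    linarith [r.2.1]
  · have h2 : ((rightGrid i m (k m + 1) : Ico t T) : ℝ) ≤ r := (h1 m).resolve_left hkm'
    have h3 : ((rightGrid i m (k m + 1) : Ico t T) : ℝ)
        = i - (i - t) * (k m / (m + 1)) - (i - t) / (m + 1) := by
      have : min (k m + 1) (m + 1) = k m + 1 := min_eq_left (by have := hkm m; omega)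
      simp only [rightGrid, this]
      push_cast
      field_simp
      ring
    linarith

end RightGridLimits

section Measurability

variable {t T : ℝ} {Ω : Type*} {V : Type*} [NormedAddCommGroup V]

theorem stronglyMeasurable_uncurry_of_rightContinuous [mΩ : MeasurableSpace Ω] (i : Ico t T)
    {u : Ico t T → Ω → V} (hu : ∀ r ≤ i, StronglyMeasurable (u r))
    (hr : ∀ ω r, ContinuousWithinAt (fun r => u r ω) (Ici r) r) :
    StronglyMeasurable fun p : Iic i × Ω => u p.1 p.2 := by
  refine stronglyMeasurable_of_tendsto atTop
    (f := fun m (p : Iic i × Ω) => stepApproxRight i m (fun r => u r p.2) p.1) (fun m => ?_)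
    (tendsto_pi_nhds.2 fun p => tendsto_stepApproxRight p.1.2 (hr p.2 p.1))
  unfold stepApproxRight
  refine ((hu i le_rfl).comp_measurable measurable_snd).add
    (Finset.stronglyMeasurable_fun_sum _ fun k _ => ?_)
  refine StronglyMeasurable.ite ?_ ?_ stronglyMeasurable_const
  · exact (measurable_subtype_coe.comp measurable_fst) measurableSet_Iio
  · exact ((hu _ (rightGrid_le i m _)).comp_measurable measurable_snd).sub
      ((hu _ (rightGrid_le i m _)).comp_measurable measurable_snd)

variable {m : MeasurableSpace Ω} {F : Filtration (Ico t T) m}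

/-- Adapted right-continuous processes are progressively measurable. -/
theorem isStronglyProgressive_of_rightContinuous {u : Ico t T → Ω → V} (hu : StronglyAdapted F u)
    (hr : ∀ ω r, ContinuousWithinAt (fun r => u r ω) (Ici r) r) : IsStronglyProgressive F u :=
  fun i => stronglyMeasurable_uncurry_of_rightContinuous (mΩ := F i) i
    (fun r hri => (hu r).mono (F.mono hri)) hr

variable [Fact (t < T)]

theorem measurable_predictable_ite {W : Type*} [Zero W] [MeasurableSpace W] {i : Ico t T}
    {w : Ω → W} (hw : Measurable[F i] w) :
    Measurable[F.predictable] fun p : Ico t T × Ω => if i < p.1 then w p.2 else 0 := by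
  intro B hB
  have e : (fun p : Ico t T × Ω => if i < p.1 then w p.2 else 0) ⁻¹' B
      = (Ioi i ×ˢ (w ⁻¹' B)) ∪ ((Ioi i ×ˢ univ)ᶜ ∩ {_p | (0 : W) ∈ B}) := by
    ext p
    by_cases hp : i < p.1 <;> simp [hp]
  rw [e]
  exact (measurableSet_predictable_Ioi_prod (hw hB)).union
    ((measurableSet_predictable_Ioi_prod (@MeasurableSet.univ _ (F i))).compl.inter
      (@MeasurableSet.const _ F.predictable _))

theorem measurable_predictable_bot {W : Type*} [MeasurableSpace W] {w : Ω → W}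
    (hw : Measurable[F ⊥] w) :
    Measurable[F.predictable] fun p : Ico t T × Ω => w p.2 := by
  intro B hB
  have e : (fun p : Ico t T × Ω => w p.2) ⁻¹' B
      = ({⊥} ×ˢ (w ⁻¹' B)) ∪ (Ioi ⊥ ×ˢ (w ⁻¹' B)) := by
    ext p
    rcases (bot_le : ⊥ ≤ p.1).eq_or_lt with hp | hp
    · simp [← hp]
    · simp [hp, hp.ne']
  rw [e]
  exact (measurableSet_predictable_singleton_bot_prod (hw hB)).union
    (measurableSet_predictable_Ioi_prod (hw hB))

variable [MeasurableSpace V] [BorelSpace V] [SecondCountableTopology V]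

/-- The left limit process of an adapted process is predictable. -/
theorem isStronglyPredictable_leftLim {u : Ico t T → Ω → V} (hu : StronglyAdapted F u)
    (hl : ∀ ω s, ∃ y, Tendsto (fun r => u r ω) (𝓝[<] s) (𝓝 y)) :
    IsStronglyPredictable F fun s ω => Function.leftLim (fun r => u r ω) s := by
  refine @stronglyMeasurable_of_tendsto _ _ _ F.predictable _ _ atTop _ _
    (fun n (p : Ico t T × Ω) => stepApprox (leftGrid n) n (fun r => u r p.2) p.1) _
    (fun n => ?_) (tendsto_pi_nhds.2 fun p => tendsto_stepApprox p.1 (hl p.2 p.1))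
  refine Measurable.stronglyMeasurable (mα := F.predictable) ?_
  unfold stepApprox
  have h0 : Measurable[F.predictable] fun p : Ico t T × Ω => u (leftGrid n 0) p.2 :=
    measurable_predictable_bot (by rw [leftGrid_zero]; exact (hu ⊥).measurable)
  have h1 : ∀ k, Measurable[F.predictable] fun p : Ico t T × Ω =>
      if leftGrid n (k + 1) < p.1 then u (leftGrid n (k + 1)) p.2 - u (leftGrid n k) p.2 else 0 :=
    fun k => measurable_predictable_ite (w := fun ω =>
      u (leftGrid n (k + 1)) ω - u (leftGrid n k) ω) ((hu _).measurable.sub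
      (((hu _).mono (F.mono (leftGrid_mono n (Nat.le_succ k)))).measurable))
  exact h0.add (Finset.measurable_fun_sum _ fun k _ => h1 k)

end Measurability

section JumpSumMeasurable

/-- The integral of a step process against a counting path is a Riemann sum. -/
theorem IsCountingPath.jumpSum_stepApprox {ι : Type*} [LinearOrder ι] [TopologicalSpace ι]
    [OrderBot ι] [OrderTopology ι] [DenselyOrdered ι] [PreconnectedSpace ι] {V : Type*}
    [AddCommGroup V] [Module ℝ V] {f : ι → ℕ} {J : ι → ℝ} (h : IsCountingPath f J) (p : ℕ → ι)
    (m : ℕ) (u : ι → V) (s : ι) :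
    jumpSum J (stepApprox p m u) s = ((f s : ℝ) - f ⊥) • u (p 0) +
      ∑ k ∈ Finset.range m, if p (k + 1) < s then
        ((f s : ℝ) - f (p (k + 1))) • (u (p (k + 1)) - u (p k)) else 0 := by
  rw [h.jumpSum_eq]
  simp only [stepApprox, smul_add, Finset.smul_sum, Finset.sum_add_distrib]
  rw [← Finset.sum_smul, h.sum_jumps, Finset.sum_comm]
  congr 1
  refine Finset.sum_congr rfl fun k _ => ?_
  have e : ∑ r ∈ h.jumps s, J r • (if p (k + 1) < r then u (p (k + 1)) - u (p k) else 0)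
      = (∑ r ∈ (h.jumps s).filter (p (k + 1) < ·), J r) • (u (p (k + 1)) - u (p k)) := by
    rw [Finset.sum_smul, Finset.sum_filter]
    refine Finset.sum_congr rfl fun r _ => ?_
    split_ifs <;> simp
  rw [e]
  split_ifs with hs
  · rw [h.sum_jumps_filter hs.le]
  · rw [Finset.filter_eq_empty_iff.2 fun r hr hlt => hs (hlt.trans_le (h.mem_jumps.1 hr).1.2),
      Finset.sum_empty, zero_smul]

variable {t T : ℝ} [Fact (t < T)] {Ω : Type*} {V : Type*} [NormedAddCommGroup V] [NormedSpace ℝ V]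
  {m : MeasurableSpace Ω} {F : Filtration (Ico t T) m}

instance : PreconnectedSpace (Ico t T) := Subtype.preconnectedSpace isPreconnected_Ico

/-- Stochastic integrals of left limits against adapted counting paths are adapted, being limits of
Riemann sums. -/
theorem stronglyAdapted_jumpSum_leftLim {f : Ico t T → Ω → ℕ} {J : Ico t T → Ω → ℝ}
    (h : ∀ ω, IsCountingPath (fun s => f s ω) (fun s => J s ω)) (hf : ∀ s, Measurable[F s] (f s))
    {u : Ico t T → Ω → V} (hu : StronglyAdapted F u)
    (hl : ∀ ω s, ∃ y, Tendsto (fun r => u r ω) (𝓝[<] s) (𝓝 y)) :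
    StronglyAdapted F fun s ω =>
      jumpSum (fun r => J r ω) (Function.leftLim fun r => u r ω) s := by
  intro s
  refine @stronglyMeasurable_of_tendsto _ _ _ (F s) _ _ atTop _ _
    (fun n ω => jumpSum (fun r => J r ω) (stepApprox (leftGrid n) n fun r => u r ω) s) _
    (fun n => ?_) (tendsto_pi_nhds.2 fun ω => ?_)
  · simp only [(h _).jumpSum_stepApprox]
    have hfs : ∀ r ≤ s, StronglyMeasurable[F s] fun ω => (f r ω : ℝ) := fun r hr =>
      (measurable_from_nat.comp ((hf r).mono (F.mono hr) le_rfl)).stronglyMeasurable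
    have hus : ∀ r ≤ s, StronglyMeasurable[F s] (u r) := fun r hr => (hu r).mono (F.mono hr)
    refine (((hfs s le_rfl).sub (hfs ⊥ bot_le)).smul ?_).add
      (Finset.stronglyMeasurable_fun_sum _ fun k _ => ?_)
    · rw [leftGrid_zero]; exact hus ⊥ bot_le
    · by_cases hk : leftGrid n (k + 1) < s
      · simp only [hk, if_true]
        exact ((hfs s le_rfl).sub (hfs _ hk.le)).smul ((hus _ hk.le).sub
          (hus _ ((leftGrid_mono n (Nat.le_succ k)).trans hk.le)))
      · simp only [hk, if_false]
        exact stronglyMeasurable_const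
  · simp only [(h ω).jumpSum_eq]
    exact tendsto_finsetSum _ fun r _ => (tendsto_stepApprox r (hl ω r)).const_smul _

variable {κ : Type*} [Fintype κ]

theorem leftLim_clm_apply {ι : Type*} [LinearOrder ι] [TopologicalSpace ι] [OrderTopology ι]
    {W : Type*} [NormedAddCommGroup W] [NormedSpace ℝ W]
    {G : ι → V →L[ℝ] W} {Z : ι → V} (hZ : ∀ s, ∃ y, Tendsto Z (𝓝[<] s) (𝓝 y))
    (hG : Continuous G) (r : ι) :
    Tendsto (fun r => G r (Z r)) (𝓝[<] r) (𝓝 (G r (Function.leftLim Z r))) ∧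
      Function.leftLim (fun r => G r (Z r)) r = G r (Function.leftLim Z r) := by
  have h1 : Tendsto (fun r => G r (Z r)) (𝓝[<] r) (𝓝 (G r (Function.leftLim Z r))) :=
    (isBoundedBilinearMap_apply.continuous.tendsto _).comp
      (((hG.tendsto r).mono_left nhdsWithin_le_nhds).prodMk_nhds
        (tendsto_leftLim_of_tendsto (hZ r)))
  refine ⟨h1, ?_⟩
  rcases (𝓝[<] r).eq_or_neBot with hb | hb
  · rw [leftLim_eq_of_eq_bot _ hb, leftLim_eq_of_eq_bot _ hb]
  · exact leftLim_eq_of_tendsto h1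

theorem stronglyAdapted_picardIter {f : κ → Ico t T → Ω → ℕ} {J : κ → Ico t T → Ω → ℝ}
    (h : ∀ ω i, IsCountingPath (fun s => f i s ω) (fun s => J i s ω))
    (hf : ∀ i s, Measurable[F s] (f i s)) {G : κ → Ico t T → V →L[ℝ] V}
    (hG : ∀ i, Continuous (G i)) (x : V) (k : ℕ) :
    StronglyAdapted F fun s ω => picardIter (fun i r => J i r ω) G x k s := by
  induction k with
  | zero => exact fun s => stronglyMeasurable_const
  | succ k ih =>
    have hl : ∀ ω s, ∃ y, Tendsto (picardIter (fun i r => J i r ω) G x k) (𝓝[<] s) (𝓝 y) :=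
      fun ω s => (isCadlagPath_picardIter (h ω) G x k s).2
    intro s
    refine stronglyMeasurable_const.sub (Finset.stronglyMeasurable_fun_sum _ fun i _ => ?_)
    have hu : StronglyAdapted F fun r ω => G i r (picardIter (fun i r => J i r ω) G x k r) :=
      fun r => (G i r).continuous.comp_stronglyMeasurable (ih r)
    have := stronglyAdapted_jumpSum_leftLim (fun ω => h ω i) (hf i) hu
      (fun ω r => ⟨_, (leftLim_clm_apply (hl ω) (hG i) r).1⟩) s
    have e : ∀ ω, Function.leftLim (fun r => G i r (picardIter (fun i r => J i r ω) G x k r))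
        = fun r => G i r (Function.leftLim (picardIter (fun i r => J i r ω) G x k) r) :=
      fun ω => funext fun r => (leftLim_clm_apply (hl ω) (hG i) r).2
    simpa only [e] using this

end JumpSumMeasurable

/-! ### Poisson processes -/

namespace IsPoissonProcess

variable {Ω : Type*} [MeasurableSpace Ω] {μ : Measure Ω} {N : ℝ≥0 → Ω → ℕ} {θ : ℝ≥0}

/-- The probability that there is an execution in `(r, s]`; it vanishes as `r` increases to `s`. -/
theorem measure_ne_eq [IsProbabilityMeasure μ] (h : IsPoissonProcess N θ μ) {r s : ℝ≥0}
    (hrs : r ≤ s) :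
    μ {ω | N s ω ≠ N r ω} = 1 - ENNReal.ofReal (Real.exp (-(θ * (s - r) : ℝ≥0))) := by
  have hl := h.law_increment r s hrs
  have e : {ω | N s ω ≠ N r ω} = (fun ω => N s ω - N r ω) ⁻¹' {0}ᶜ := by
    ext ω
    have := h.monotone ω hrs
    simp only [mem_preimage, mem_compl_iff, mem_singleton_iff]
    change N r ω ≤ N s ω at this
    change N s ω ≠ N r ω ↔ _
    omega
  rw [e, ← Measure.map_apply_of_aemeasurable hl.aemeasurable (measurableSet_singleton 0).compl,
    hl.map_eq, prob_compl_eq_one_sub (measurableSet_singleton 0), poissonMeasure_singleton]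
  simp

/-- Exponential moments of a Poisson variable are finite. -/
theorem lintegral_pow_lt_top (h : IsPoissonProcess N θ μ) (a : ℝ≥0) (s : ℝ≥0) :
    ∫⁻ ω, (a : ℝ≥0∞) ^ N s ω ∂μ < ∞ := by
  have hl := h.law_increment 0 s bot_le
  simp only [h.zero, tsub_zero] at hl
  have e : ∫⁻ ω, (a : ℝ≥0∞) ^ N s ω ∂μ = ∫⁻ k, (a : ℝ≥0∞) ^ k ∂poissonMeasure (θ * s) := by
    rw [← hl.map_eq, lintegral_map' (by fun_prop) hl.aemeasurable]
  rw [e]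
  have hi : Integrable (fun k : ℕ => (a : ℝ) ^ k) (poissonMeasure (θ * s)) := by
    rw [integrable_poissonMeasure_iff]
    have := (Real.summable_pow_div_factorial (((θ * s : ℝ≥0) : ℝ) * a)).mul_left
      (Real.exp (-(θ * s : ℝ≥0)))
    refine this.congr fun k => ?_
    rw [Real.norm_of_nonneg (by positivity), mul_pow]
    ring
  have := hi.hasFiniteIntegral
  rw [HasFiniteIntegral] at this
  refine lt_of_eq_of_lt (lintegral_congr fun k => ?_) this
  rw [enorm_pow]
  simp

/-- The restriction of a Poisson path to `[t, T)`. Here `jump` is evaluated in `[0, ∞)`; at interior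
times of `[t, T)` the left limits in both spaces agree. -/
theorem isCountingPath (h : IsPoissonProcess N θ μ) (ω : Ω) {t T : ℝ} (ht : 0 ≤ t) :
    IsCountingPath (fun s : Ico t T => N (s : ℝ).toNNReal ω)
      (fun s : Ico t T => jump (fun q => N q ω) (s : ℝ).toNNReal) := by
  have hmono : Monotone fun s : Ico t T => (s : ℝ).toNNReal := fun a b hab =>
    Real.toNNReal_le_toNNReal hab
  have hcont : Continuous fun s : Ico t T => (s : ℝ).toNNReal :=
    continuous_real_toNNReal.comp continuous_subtype_val
  have hlt : ∀ a b : Ico t T, a < b → (a : ℝ).toNNReal < (b : ℝ).toNNReal := fun a b hab =>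
    (Real.toNNReal_lt_toNNReal_iff_of_nonneg (ht.trans a.2.1)).2 hab
  refine ⟨fun a b hab => h.monotone ω (hmono hab), fun s => ?_, fun s => ?_⟩
  · have h1 := (h.cadlag ω (s : ℝ).toNNReal).1
    have h2 : Tendsto (fun r : Ico t T => (r : ℝ).toNNReal) (𝓝[≥] s) (𝓝[≥] (s : ℝ).toNNReal) :=
      tendsto_nhdsWithin_iff.2 ⟨hcont.continuousWithinAt, by
        filter_upwards [self_mem_nhdsWithin] with r hr using hmono hr⟩
    have h3 := h1.tendsto.comp h2
    rw [nhds_discrete, tendsto_pure] at h3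
    exact h3
  · obtain ⟨y, hy⟩ := (h.cadlag ω (s : ℝ).toNNReal).2
    rw [nhds_discrete, tendsto_pure] at hy
    have h2 : Tendsto (fun r : Ico t T => (r : ℝ).toNNReal) (𝓝[<] s) (𝓝[<] (s : ℝ).toNNReal) :=
      tendsto_nhdsWithin_iff.2 ⟨hcont.continuousWithinAt, by
        filter_upwards [self_mem_nhdsWithin] with r hr using hlt r s hr⟩
    filter_upwards [h2.eventually hy, self_mem_nhdsWithin] with r hr hrs
    have hne : (𝓝[<] (s : ℝ).toNNReal).NeBot := nhdsLT_neBot_of_exists_lt ⟨_, hlt r s hrs⟩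
    rw [jump, leftLim_eq_of_tendsto (y := (y : ℝ)), hr]
    exact tendsto_nhds_of_eventually_eq (hy.mono fun q hq => by rw [hq])

end IsPoissonProcess

/-- Reduces exponential moments of a sum to those of the summands, each summand being estimated by
the largest one. -/
theorem pow_sum_le_one_add_sum {n : ℕ} {a : ℝ≥0∞} (ha : 1 ≤ a) (N : Fin n → ℕ) :
    a ^ (∑ i, N i) ≤ 1 + ∑ i, (a ^ n) ^ N i := by
  rcases Nat.eq_zero_or_pos n with rfl | hn
  · simp
  have : Nonempty (Fin n) := ⟨⟨0, hn⟩⟩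
  obtain ⟨j, hj⟩ := Finite.exists_max N
  have h1 : ∑ i, N i ≤ n * N j := by
    have := Finset.sum_le_card_nsmul Finset.univ N (N j) fun i _ => hj i
    simpa using this
  calc a ^ (∑ i, N i) ≤ a ^ (n * N j) := pow_le_pow_right₀ ha h1
    _ = (a ^ n) ^ N j := pow_mul _ _ _
    _ ≤ ∑ i, (a ^ n) ^ N i :=
      Finset.single_le_sum (f := fun i => (a ^ n) ^ N i) (fun i _ => zero_le) (Finset.mem_univ j)
    _ ≤ _ := le_add_self

namespace Market

variable {n : ℕ} {Ω : Type*} [m : MeasurableSpace Ω] {μ : Measure Ω} (M : Market n μ)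

theorem lintegral_pow_sum_lt_top [IsProbabilityMeasure μ] {a : ℝ≥0} (ha : 1 ≤ a) (s : ℝ≥0) :
    ∫⁻ ω, (a : ℝ≥0∞) ^ (∑ i, M.π i s ω) ∂μ < ∞ := by
  refine (lintegral_mono fun ω => pow_sum_le_one_add_sum (by exact_mod_cast ha) _).trans_lt ?_
  have hmeas : ∀ i, Measurable fun ω => ((a : ℝ≥0∞) ^ n) ^ M.π i s ω := fun i =>
    (measurable_from_nat (f := fun k => ((a : ℝ≥0∞) ^ n) ^ k)).comp ((M.π_poisson i).measurable s)
  rw [lintegral_add_left measurable_const, lintegral_finsetSum _ fun i _ => hmeas i]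
  refine ENNReal.add_lt_top.2 ⟨by simp, ENNReal.sum_lt_top.2 fun i _ => ?_⟩
  have := (M.π_poisson i).lintegral_pow_lt_top (a ^ n) s
  simpa using this

/-- The completed filtration also contains the current value of the Poisson processes, which almost
surely do not jump at a fixed time. -/
theorem measurable_π_filtration [IsProbabilityMeasure μ] (i : Fin n) (s : ℝ) :
    Measurable[M.filtration s] (M.π i s.toNNReal) := by
  have hP := M.π_poisson i
  have hnull : ∀ A, MeasurableSet[m] A → μ A = 0 → MeasurableSet[M.filtration s] A :=
    fun A hA hA0 => (le_sup_right :
      MeasurableSpace.generateFrom {A | MeasurableSet[m] A ∧ μ A = 0} ≤ M.filtration s) _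
      (MeasurableSpace.measurableSet_generateFrom ⟨hA, hA0⟩)
  have hlt : ∀ r : ℝ≥0, (r : ℝ) < s → Measurable[M.filtration s] (M.π i r) := fun r hr => by
    rw [measurable_iff_comap_le]
    refine le_trans ?_ (le_sup_left.trans' le_sup_right :
      (⨆ i : Fin n, ⨆ r : ℝ≥0, ⨆ _ : (r : ℝ) < s, MeasurableSpace.comap (M.π i r) inferInstance)
        ≤ M.filtration s)
    exact le_iSup_of_le i (le_iSup_of_le r (le_iSup_of_le hr le_rfl))
  rcases le_or_gt s 0 with hs | hs
  · rw [Real.toNNReal_of_nonpos hs, show M.π i 0 = fun _ => 0 from funext hP.zero]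
    exact measurable_const
  set s' := s.toNNReal with hs'
  have hs'0 : 0 < s' := Real.toNNReal_pos.2 hs
  have hs's : (s' : ℝ) = s := Real.coe_toNNReal _ hs.le
  -- The event `c ≤ π(s)` differs by a null event from `c ≤ π(s-)`, the union of the events
  -- `c ≤ π(r k)` for times `r k` increasing to `s`.
  set r : ℕ → ℝ≥0 := fun k => s' - s' / (k + 1) with hr
  have hrlt : ∀ k, r k < s' := fun k => tsub_lt_self hs'0 (by positivity)
  have hrs : ∀ k, s' - r k = s' / (k + 1) := fun k =>
    tsub_tsub_cancel_of_le (div_le_self bot_le (by simp))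
  refine measurable_of_Ici fun c => ?_
  set A : Set Ω := ⋃ k, {ω | c ≤ M.π i (r k) ω} with hA
  have hAm : MeasurableSet[M.filtration s] A := MeasurableSet.iUnion fun k =>
    hlt (r k) (by rw [← hs's]; exact_mod_cast hrlt k) measurableSet_Ici
  have hAsub : A ⊆ M.π i s' ⁻¹' Ici c := iUnion_subset fun k ω hω =>
    le_trans (show c ≤ M.π i (r k) ω from hω) (hP.monotone ω (hrlt k).le)
  have hD : μ (M.π i s' ⁻¹' Ici c \ A) = 0 := by
    have hle : ∀ k : ℕ, μ (M.π i s' ⁻¹' Ici c \ A)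
        ≤ 1 - ENNReal.ofReal (Real.exp (-(M.θ i * (s' / (k + 1)) : ℝ≥0))) := fun k => by
      rw [← hrs k, ← hP.measure_ne_eq (hrlt k).le]
      refine measure_mono fun ω hω he => hω.2 ?_
      have h1 : c ≤ M.π i s' ω := hω.1
      exact mem_iUnion.2 ⟨k, (show c ≤ M.π i (r k) ω from he ▸ h1)⟩
    have hlim : Tendsto (fun k : ℕ => 1 - ENNReal.ofReal
        (Real.exp (-(M.θ i * (s' / (k + 1)) : ℝ≥0)))) atTop (𝓝 0) := by
      have h1 : Tendsto (fun k : ℕ => -((M.θ i : ℝ) * ((s' : ℝ) / ((k : ℝ) + 1)))) atTop (𝓝 0) := by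
        simpa using ((tendsto_mesh (s' : ℝ)).const_mul (M.θ i : ℝ)).neg
      have h2 := ENNReal.tendsto_ofReal ((Real.continuous_exp.tendsto 0).comp h1)
      have h3 := ENNReal.Tendsto.sub (tendsto_const_nhds (x := (1 : ℝ≥0∞))) h2
        (Or.inl ENNReal.one_ne_top)
      simpa [Function.comp_def] using h3
    exact le_antisymm (ge_of_tendsto' hlim hle) zero_le
  have hm : MeasurableSet[m] (M.π i s' ⁻¹' Ici c) := hP.measurable s' measurableSet_Ici
  rw [← sdiff_union_of_subset hAsub]
  exact (hnull _ (hm.diff (M.filtration.le s _ hAm)) hD).union hAm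

/-! ### The closed-loop equation -/

/-- `feedbackXi` as a continuous linear map. -/
noncomputable def xiCLM (C : ℝ → Matrix (Fin n) (Fin n) ℝ) (s : ℝ) :
    EuclideanSpace ℝ (Fin n) →L[ℝ] EuclideanSpace ℝ (Fin n) :=
  Matrix.toEuclideanCLM (𝕜 := ℝ) (M.Λ⁻¹ * C s)

/-- `feedbackEta` as a continuous linear map. -/
noncomputable def etaCLM (C : ℝ → Matrix (Fin n) (Fin n) ℝ) (s : ℝ) :
    EuclideanSpace ℝ (Fin n) →L[ℝ] EuclideanSpace ℝ (Fin n) :=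
  Matrix.toEuclideanCLM (𝕜 := ℝ)
    (Matrix.diagonal (fun i => if 0 < M.θ i then (1 : ℝ) else 0) *
      Matrix.diagonal (fun i => 1 / C s i i) * C s)

theorem feedbackXi_eq (C : ℝ → Matrix (Fin n) (Fin n) ℝ) (s : ℝ) (y : EuclideanSpace ℝ (Fin n)) :
    M.feedbackXi C s y = M.xiCLM C s y := rfl

theorem feedbackEta_eq (C : ℝ → Matrix (Fin n) (Fin n) ℝ) (s : ℝ)
    (y : EuclideanSpace ℝ (Fin n)) : M.feedbackEta C s y = M.etaCLM C s y := rfl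

theorem continuous_toEuclideanCLM : Continuous (Matrix.toEuclideanCLM (𝕜 := ℝ) :
    Matrix (Fin n) (Fin n) ℝ → EuclideanSpace ℝ (Fin n) →L[ℝ] EuclideanSpace ℝ (Fin n)) :=
  (Matrix.toEuclideanCLM (n := Fin n)
    (𝕜 := ℝ)).toAlgEquiv.toLinearMap.continuous_of_finiteDimensional

variable {C : ℝ → Matrix (Fin n) (Fin n) ℝ}

theorem continuous_xiCLM (hC : Continuous C) : Continuous (M.xiCLM C) :=
  continuous_toEuclideanCLM.comp (continuous_const.matrix_mul hC)

theorem continuous_etaCLM (hC : Continuous C) (hd : ∀ s i, C s i i ≠ 0) :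
    Continuous (M.etaCLM C) := by
  refine continuous_toEuclideanCLM.comp ((continuous_const.matrix_mul ?_).matrix_mul hC)
  refine Continuous.matrix_diagonal (continuous_pi fun i => ?_)
  exact continuous_const.div (hC.matrix_elem i i) fun s => hd s i

/-- The orthogonal projection onto the `i`-th coordinate axis. -/
noncomputable def axisProj (i : Fin n) :
    EuclideanSpace ℝ (Fin n) →L[ℝ] EuclideanSpace ℝ (Fin n) :=
  (EuclideanSpace.proj (𝕜 := ℝ) i).smulRight (EuclideanSpace.single i (1 : ℝ))

theorem axisProj_apply (i : Fin n) (v : EuclideanSpace ℝ (Fin n)) :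
    axisProj i v = v i • EuclideanSpace.single i (1 : ℝ) := rfl

/-- The counting paths of the Poisson processes on `[t, T)`. -/
def countPath (t : ℝ) (i : Fin n) (s : Ico t M.T) (ω : Ω) : ℕ := M.π i (s : ℝ).toNNReal ω

/-- The jumps of the Poisson processes on `[t, T)`. -/
noncomputable def countJump (t : ℝ) (i : Fin n) (s : Ico t M.T) (ω : Ω) : ℝ :=
  jump (fun q => M.π i q ω) (s : ℝ).toNNReal

variable {t : ℝ}

theorem isCountingPath_countPath (ht : 0 ≤ t) (ω : Ω) (i : Fin n) :
    IsCountingPath (fun s => M.countPath t i s ω) (fun s => M.countJump t i s ω) :=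
  (M.π_poisson i).isCountingPath ω ht

variable [Fact (t < M.T)]

/-- The dark pool integral as a sum of scalar-driven jump sums, one for each Poisson process. -/
theorem darkPoolIntegral_eq (ht : 0 ≤ t) (η : Ico t M.T → Ω → EuclideanSpace ℝ (Fin n))
    (s : Ico t M.T) (ω : Ω) :
    M.darkPoolIntegral η s ω =
      ∑ i, jumpSum (fun r => M.countJump t i r ω) (fun r => axisProj i (η r ω)) s := by
  have h := M.isCountingPath_countPath ht ω
  have e : ∀ i, jumpSum (fun r => M.countJump t i r ω) (fun r => axisProj i (η r ω)) s
      = jumpSum (fun r => M.countJump t i r ω) (fun r => η r ω i) s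
        • EuclideanSpace.single i (1 : ℝ) := fun i => by
    simp only [(h i).jumpSum_eq, axisProj_apply, Finset.sum_smul, smul_smul, smul_eq_mul]
  simp only [e]
  ext j
  have hj : M.darkPoolIntegral η s ω j
      = jumpSum (fun r => M.countJump t j r ω) (fun r => η r ω j) s := by
    simp only [darkPoolIntegral, jumpSum, smul_eq_mul]
    refine finsum_congr fun r => finsum_congr_Prop rfl fun _ => mul_comm _ _
  rw [hj]
  simp [Pi.single_apply]

/-- The jump coefficient of the transformed process `Z = Φ⁻¹ X`. -/
noncomputable def jumpCoeff (C : ℝ → Matrix (Fin n) (Fin n) ℝ)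
    (Φ Ψ : ℝ → EuclideanSpace ℝ (Fin n) →L[ℝ] EuclideanSpace ℝ (Fin n)) (i : Fin n)
    (r : Ico t M.T) : EuclideanSpace ℝ (Fin n) →L[ℝ] EuclideanSpace ℝ (Fin n) :=
  Ψ r * (axisProj i * (M.etaCLM C r * Φ r))

/-- Pathwise solution theory: `Y` solves the closed-loop equation along the path `ω` if and only if
`Y = Φ Z` for the solution `Z` of the transformed pure jump equation. -/
theorem closedLoop_path_iff (ht : 0 ≤ t) (hC : Continuous C)
    {Φ Ψ : ℝ → EuclideanSpace ℝ (Fin n) →L[ℝ] EuclideanSpace ℝ (Fin n)}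
    (hΦt : Φ t = 1)
    (hΦ : ∀ r ∈ Icc t M.T, HasDerivWithinAt Φ (-(M.xiCLM C r * Φ r)) (Icc t M.T) r)
    (hΨ : ∀ r ∈ Icc t M.T, Φ r * Ψ r = 1) (x : EuclideanSpace ℝ (Fin n)) (ω : Ω)
    {Z : Ico t M.T → EuclideanSpace ℝ (Fin n)}
    (hZ : IsJumpSolution (fun i r => M.countJump t i r ω) (M.jumpCoeff C Φ Ψ) x Z)
    (Y : Ico t M.T → Ω → EuclideanSpace ℝ (Fin n)) :
    (∀ s, IntegrableOn (fun r => M.xiStar C Y r ω) (Iic s) (timeMeasure t M.T) ∧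
      Y s ω = x - (∫ r in Iic s, M.xiStar C Y r ω ∂timeMeasure t M.T)
        - M.darkPoolIntegral (M.etaStar C Y) s ω) ↔ ∀ s, Y s ω = Φ s (Z s) := by
  have h := M.isCountingPath_countPath ht ω
  have hΦc : Continuous fun r : Ico t M.T => Φ r :=
    continuousOn_iff_continuous_domRestrict.1 fun r hr =>
      ((hΦ r (Ico_subset_Icc_self hr)).continuousWithinAt).mono Ico_subset_Icc_self
  have hA := (M.continuous_xiCLM hC).continuousOn (s := Icc t M.T)
  have hvar := fun g X hX s => variation_of_constants h hA hΦt hΦ hΨ x g (X := X) hX s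
  have hlim : ∀ W : Ico t M.T → EuclideanSpace ℝ (Fin n), IsCadlagPath W →
      ∀ r : Ico t M.T, Function.leftLim (fun r : Ico t M.T => Φ r (W r)) r
        = Φ r (Function.leftLim W r) := fun W hW r =>
    (leftLim_clm_apply (fun s => (hW s).2) hΦc r).2
  simp only [darkPoolIntegral_eq M ht]
  constructor
  · intro hY
    -- Solve the equation with the jump part of `Y` by variation of constants and compare.
    set g : Fin n → Ico t M.T → EuclideanSpace ℝ (Fin n) :=
      fun i r => axisProj i (M.etaStar C Y r ω) with hg
    set W : Ico t M.T → EuclideanSpace ℝ (Fin n) := fun s =>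
      x - ∑ i, jumpSum (fun r => M.countJump t i r ω) (fun r => Ψ r (g i r)) s with hW
    have hX := hvar g (fun s => Φ s (W s)) fun s => rfl
    have hYW : ∀ s, Y s ω = Φ s (W s) := by
      intro s
      rw [← sub_eq_zero]
      refine eq_zero_of_integral_equation (D := fun s => Y s ω - Φ s (W s)) hA (fun s => ?_)
        (fun s => ?_) s
      · simp only [map_sub]
        exact (hY s).1.sub (hX s).1
      · simp only [map_sub]
        have hYi : IntegrableOn (fun r : Ico t M.T => M.xiCLM C r (Y r ω)) (Iic s)
            (timeMeasure t M.T) := (hY s).1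
        rw [integral_sub hYi (hX s).1]
        have h1 := (hY s).2
        have h2 := (hX s).2
        simp only [hg] at h2
        simp only [xiStar, feedbackXi_eq] at h1 ⊢
        rw [h1]
        conv_lhs => rw [h2]
        abel
    have hWc : IsCadlagPath W := isCadlagPath_jumpProcess h x _
    have hWs : IsJumpSolution (fun i r => M.countJump t i r ω) (M.jumpCoeff C Φ Ψ) x W := by
      intro s
      have : ∀ r, Function.leftLim (fun r => Y r ω) r = Φ r (Function.leftLim W r) := fun r => by
        rw [funext hYW, hlim W hWc r]
      have e : ∀ i (r : Ico t M.T), Ψ r (g i r)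
          = M.jumpCoeff C Φ Ψ i r (Function.leftLim W r) := fun i r => by
        simp only [hg, etaStar, feedbackEta_eq, this]
        rfl
      change x - ∑ i, jumpSum _ (fun r : Ico t M.T => Ψ r (g i r)) s = _
      simp only [e]
    intro s
    rw [hYW s, hWs.unique h hZ]
  · intro hY s
    have hfun := funext hY
    have hg : ∀ i r, M.jumpCoeff C Φ Ψ i r (Function.leftLim Z r)
        = Ψ r (axisProj i (M.etaStar C Y r ω)) := fun i r => by
      rw [etaStar, feedbackEta_eq, hfun, hlim Z (hZ.isCadlagPath h) r]
      rfl
    refine hvar (fun i r => axisProj i (M.etaStar C Y r ω)) (fun s => Y s ω) (fun s => ?_) s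
    rw [hY s, hZ s]
    simp only [hg]

end Market

theorem norm_leftLim_le {ι : Type*} [LinearOrder ι] [TopologicalSpace ι] [OrderTopology ι]
    {V : Type*} [NormedAddCommGroup V] {u : ι → V} {B : ℝ} (hB : ∀ s, ‖u s‖ ≤ B) (s : ι)
    (hu : ∃ y, Tendsto u (𝓝[<] s) (𝓝 y)) : ‖Function.leftLim u s‖ ≤ B := by
  rcases (𝓝[<] s).eq_or_neBot with hb | hb
  -- Without earlier times, the left limit is the value itself.
  · rw [leftLim_eq_of_eq_bot _ hb]; exact hB s
  · exact le_of_tendsto (tendsto_leftLim_of_tendsto hu).norm (Eventually.of_forall hB)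

namespace Market

variable {n : ℕ} {Ω : Type*} [m : MeasurableSpace Ω] {μ : Measure Ω} (M : Market n μ)

/-! ### Admissibility of the closed-loop strategy -/

/-- A process bounded by an exponential of the number of dark pool executions has all moments. -/
theorem lintegral_moment_lt_top [IsProbabilityMeasure μ] {t : ℝ} {b a : ℝ} (ha : 1 ≤ a)
    {ξ : Ico t M.T → Ω → EuclideanSpace ℝ (Fin n)} {s : ℝ≥0}
    (hξ : ∀ r ω, ‖ξ r ω‖ ≤ b * a ^ (∑ i, M.π i s ω)) (p : ℕ) :
    ∫⁻ ω, (∫⁻ r, ‖ξ r ω‖ₑ ^ p ∂timeMeasure t M.T) ∂μ < ∞ := by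
  have hvol : timeMeasure t M.T univ < ∞ := by
    rw [timeMeasure, (MeasurableEmbedding.subtype_coe measurableSet_Ico).comap_apply, image_univ,
      Subtype.range_coe, Real.volume_Ico]
    exact ENNReal.ofReal_lt_top
  have ha0 : 0 ≤ a := zero_le_one.trans ha
  have hle : ∀ r ω, ‖ξ r ω‖ₑ ^ p ≤ (b.toNNReal : ℝ≥0∞) ^ p *
      ((a.toNNReal ^ p : ℝ≥0) : ℝ≥0∞) ^ (∑ i, M.π i s ω) := fun r ω => by
    have h1 : ‖ξ r ω‖ₑ ≤ (b.toNNReal : ℝ≥0∞) * (a.toNNReal : ℝ≥0∞) ^ (∑ i, M.π i s ω) := by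
      rw [← ofReal_norm]
      refine (ENNReal.ofReal_le_ofReal (hξ r ω)).trans ?_
      rw [ENNReal.ofReal_mul' (pow_nonneg ha0 _), ENNReal.ofReal_pow ha0]
      rfl
    refine (pow_le_pow_left₀ zero_le h1 p).trans_eq ?_
    rw [mul_pow, ENNReal.coe_pow, ← pow_mul, ← pow_mul, mul_comm p]
  have h2 : ∀ ω, (∫⁻ r, ‖ξ r ω‖ₑ ^ p ∂timeMeasure t M.T) ≤
      ((b.toNNReal : ℝ≥0∞) ^ p * timeMeasure t M.T univ) *
      ((a.toNNReal ^ p : ℝ≥0) : ℝ≥0∞) ^ (∑ i, M.π i s ω) := fun ω => by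
    refine (lintegral_mono fun r => hle r ω).trans_eq ?_
    rw [lintegral_const]
    ring
  have hfin : (b.toNNReal : ℝ≥0∞) ^ p * timeMeasure t M.T univ ≠ ∞ :=
    ENNReal.mul_ne_top (ENNReal.pow_ne_top ENNReal.coe_ne_top) hvol.ne
  refine (lintegral_mono h2).trans_lt ?_
  rw [lintegral_const_mul' _ _ hfin]
  exact ENNReal.mul_lt_top hfin.lt_top (M.lintegral_pow_sum_lt_top
    (one_le_pow₀ (by simpa using ha)) s)

theorem feedbackEta_apply_eq_zero {C : ℝ → Matrix (Fin n) (Fin n) ℝ} {i : Fin n}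
    (hi : M.θ i = 0) (s : ℝ) (y : EuclideanSpace ℝ (Fin n)) : M.feedbackEta C s y i = 0 := by
  rw [feedbackEta, Matrix.toLpLin_apply]
  simp [← Matrix.mulVec_mulVec, Matrix.mulVec_diagonal, hi]

variable {C : ℝ → Matrix (Fin n) (Fin n) ℝ} {t : ℝ} [Fact (t < M.T)]

/-- For a continuous `C` with nonvanishing diagonal, the closed-loop equation is uniquely solvable
and the feedback strategy is admissible. -/
theorem exists_closedLoop [IsProbabilityMeasure μ] (hC : Continuous C) (hd : ∀ s i, C s i i ≠ 0)
    (ht : 0 ≤ t) (x : EuclideanSpace ℝ (Fin n)) :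
    ∃ X : Ico t M.T → Ω → EuclideanSpace ℝ (Fin n), M.IsClosedLoopSolution C t x X ∧
      (∀ Y, M.IsClosedLoopSolution C t x Y → ∀ᵐ ω ∂μ, ∀ s, Y s ω = X s ω) ∧
      M.IsAdmissible t x (M.xiStar C X) (M.etaStar C X) := by
  have htT : t < M.T := Fact.out
  obtain ⟨Φ, Ψ, hΦt, hΦ, hΨc, hΨ⟩ := exists_fundamental_solution htT.le
    (M.continuous_xiCLM hC).continuousOn
  have hΦc : ContinuousOn Φ (Icc t M.T) := fun r hr => (hΦ r hr).continuousWithinAt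
  have hres : ∀ {f : ℝ → EuclideanSpace ℝ (Fin n) →L[ℝ] EuclideanSpace ℝ (Fin n)},
      ContinuousOn f (Icc t M.T) → Continuous fun r : Ico t M.T => f r := fun hf =>
    continuousOn_iff_continuous_domRestrict.1 (hf.mono Ico_subset_Icc_self)
  have hξc : Continuous fun r : Ico t M.T => M.xiCLM C r :=
    (M.continuous_xiCLM hC).comp continuous_subtype_val
  have hηc : Continuous fun r : Ico t M.T => M.etaCLM C r :=
    (M.continuous_etaCLM hC hd).comp continuous_subtype_val
  set G := M.jumpCoeff (t := t) C Φ Ψ with hG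
  have hGcc : ∀ i, ContinuousOn (fun r => Ψ r * (axisProj i * (M.etaCLM C r * Φ r))) (Icc t M.T) :=
    fun i => hΨc.mul (continuousOn_const.mul
      ((M.continuous_etaCLM hC hd).continuousOn.mul hΦc))
  have hGc : ∀ i, Continuous (G i) := fun i => hres (hGcc i)
  have hJ := M.isCountingPath_countPath (t := t) ht
  -- The total number of executions bounds the number of Picard steps that are needed.
  set N : Ω → ℕ := fun ω => ∑ i, M.π i M.T.toNNReal ω with hN
  have hfN : ∀ (s : Ico t M.T) ω, ∑ i, M.countPath t i s ω ≤ N ω := fun s ω =>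
    Finset.sum_le_sum fun i _ =>
      (M.π_poisson i).monotone ω (Real.toNNReal_le_toNNReal s.2.2.le)
  set Z : Ico t M.T → Ω → EuclideanSpace ℝ (Fin n) := fun s ω =>
    picardIter (fun i r => M.countJump t i r ω) G x (N ω) s with hZ_def
  have hZ : ∀ ω, IsJumpSolution (fun i r => M.countJump t i r ω) G x (fun s => Z s ω) := fun ω =>
    isJumpSolution_picardIter (hJ ω) G x (N ω) fun s => (hfN s ω).trans (Nat.le_add_left _ _)
  have hZc : ∀ ω, IsCadlagPath fun s => Z s ω := fun ω => (hZ ω).isCadlagPath (hJ ω)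
  have hfm : ∀ i s, Measurable[M.filtrationFrom t s] (M.countPath t i s) := fun i s =>
    M.measurable_π_filtration i s
  have hZa : StronglyAdapted (M.filtrationFrom t) Z := fun s => by
    -- `N` is not known at time `s`, so `Z` is adapted as the limit of the iterates.
    refine @stronglyMeasurable_of_tendsto _ _ _ (M.filtrationFrom t s) _ _ atTop _ _
      (fun k ω => picardIter (fun i r => M.countJump t i r ω) G x k s) _
      (fun k => stronglyAdapted_picardIter hJ hfm hGc x k s) (tendsto_pi_nhds.2 fun ω => ?_)
    refine tendsto_nhds_of_eventually_eq ?_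
    filter_upwards [eventually_ge_atTop (N ω)] with k hk
    exact picardIter_eq_of_le (hJ ω) G x hk s ((hfN s ω).trans (Nat.le_add_left _ _))
  set X : Ico t M.T → Ω → EuclideanSpace ℝ (Fin n) := fun s ω => Φ s (Z s ω) with hX
  have hXa : StronglyAdapted (M.filtrationFrom t) X := fun s =>
    (Φ s).continuous.comp_stronglyMeasurable (hZa s)
  have hXc : ∀ ω, IsCadlagPath fun s => X s ω := fun ω s =>
    ⟨((hres hΦc).continuousWithinAt).clm_apply (hZc ω s).1, _,
      (leftLim_clm_apply (fun s => (hZc ω s).2) (hres hΦc) s).1⟩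
  have hiff := fun ω Y => M.closedLoop_path_iff ht hC hΦt hΦ hΨ x ω (hZ ω) Y
  have hsol : M.IsClosedLoopSolution C t x X :=
    ⟨hXc, hXa, Eventually.of_forall fun ω => (hiff ω X).2 fun s => rfl⟩
  -- Exponential bound for the solution in terms of the number of executions.
  obtain ⟨K, hK⟩ := isCompact_Icc.exists_bound_of_continuousOn
    (continuousOn_pi.2 hGcc)
  obtain ⟨B, hB⟩ := isCompact_Icc.exists_bound_of_continuousOn hΦc
  obtain ⟨Bξ, hBξ⟩ := isCompact_Icc.exists_bound_of_continuousOn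
    ((M.continuous_xiCLM hC).continuousOn (s := Icc t M.T))
  obtain ⟨Bη, hBη⟩ := isCompact_Icc.exists_bound_of_continuousOn
    ((M.continuous_etaCLM hC hd).continuousOn (s := Icc t M.T))
  have htm : t ∈ Icc t M.T := left_mem_Icc.2 htT.le
  have hK0 : 0 ≤ K := (norm_nonneg _).trans (hK t htm)
  have hB0 : 0 ≤ B := (norm_nonneg _).trans (hB t htm)
  have hBξ0 : 0 ≤ Bξ := (norm_nonneg _).trans (hBξ t htm)
  have hBη0 : 0 ≤ Bη := (norm_nonneg _).trans (hBη t htm)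
  have hXb : ∀ ω s, ‖X s ω‖ ≤ B * ‖x‖ * (1 + K) ^ N ω := fun ω s => by
    have h1 := (hZ ω).norm_le (hJ ω) hK0 (fun i r =>
      (norm_le_pi_norm (fun i => G i r) i).trans (hK r (Ico_subset_Icc_self r.2))) s
    have h2 : (1 + K) ^ (∑ i, M.countPath t i s ω - ∑ i, M.countPath t i ⊥ ω)
        ≤ (1 + K) ^ N ω :=
      pow_le_pow_right₀ (by linarith) ((Nat.sub_le _ _).trans (hfN s ω))
    rw [mul_assoc]
    exact ((Φ s).le_of_opNorm_le (hB s (Ico_subset_Icc_self s.2)) _).trans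
      (mul_le_mul_of_nonneg_left (h1.trans (mul_le_mul_of_nonneg_left h2 (norm_nonneg _))) hB0)
  refine ⟨X, hsol, fun Y hY => ?_, ?_, ?_, ?_, ?_, ?_, ?_⟩
  · filter_upwards [hY.equation] with ω hω
    exact (hiff ω Y).1 hω
  · refine isStronglyProgressive_of_rightContinuous
      (fun s => (M.xiCLM C s).continuous.comp_stronglyMeasurable (hXa s)) fun ω r => ?_
    exact hξc.continuousWithinAt.clm_apply (hXc ω r).1
  · have e : M.etaStar C X = fun (s : Ico t M.T) ω =>
        Function.leftLim (fun r : Ico t M.T => M.etaCLM C r (X r ω)) s := by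
      funext s ω
      exact (leftLim_clm_apply (fun s => (hXc ω s).2) hηc s).2.symm
    rw [e]
    exact isStronglyPredictable_leftLim
      (fun s => (M.etaCLM C s).continuous.comp_stronglyMeasurable (hXa s))
      fun ω s => ⟨_, (leftLim_clm_apply (fun s => (hXc ω s).2) hηc s).1⟩
  · -- With the controls fixed, the right-hand side of the equation does not involve the unknown.
    refine ⟨X, hsol, fun Y hY => ?_⟩
    filter_upwards [hY.equation, hsol.equation] with ω h1 h2 s
    rw [(h1 s).2, (h2 s).2]
  · refine M.lintegral_moment_lt_top (b := Bξ * (B * ‖x‖)) (a := 1 + K) (s := M.T.toNNReal)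
      (by linarith) (fun r ω => ?_) 4
    rw [mul_assoc]
    exact ((M.xiCLM C r).le_of_opNorm_le (hBξ r (Ico_subset_Icc_self r.2)) _).trans
      (mul_le_mul_of_nonneg_left (hXb ω r) hBξ0)
  · refine M.lintegral_moment_lt_top (b := Bη * (B * ‖x‖)) (a := 1 + K) (s := M.T.toNNReal)
      (by linarith) (fun r ω => ?_) 8
    rw [mul_assoc]
    exact ((M.etaCLM C r).le_of_opNorm_le (hBη r (Ico_subset_Icc_self r.2)) _).trans
      (mul_le_mul_of_nonneg_left (norm_leftLim_le (hXb ω) r (hXc ω r).2) hBη0)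
  · exact fun i hi s ω => M.feedbackEta_apply_eq_zero hi s _

end Market

end DarkPool

theorem mainTheorem7 {n : ℕ} [NeZero n] {Ω : Type*} [MeasurableSpace Ω] {μ : Measure Ω}
    [IsProbabilityMeasure μ] (M : DarkPool.Market n μ) (l : ℝ) (hl : M.l₀ < l) :
    ∃ C : ℝ → Matrix (Fin n) (Fin n) ℝ,
      (M.IsRiccatiSolution l C ∧ ∀ C', M.IsRiccatiSolution l C' → EqOn C' C (Icc 0 M.T)) ∧
      ∀ t : ℝ, 0 ≤ t → ∀ htT : t < M.T, ∀ x : EuclideanSpace ℝ (Fin n),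
        haveI : Fact (t < M.T) := ⟨htT⟩
        ∃ X : Ico t M.T → Ω → EuclideanSpace ℝ (Fin n),
          M.IsClosedLoopSolution C t x X ∧
          (∀ Y, M.IsClosedLoopSolution C t x Y → ∀ᵐ ω ∂μ, ∀ s, Y s ω = X s ω) ∧
          M.IsAdmissible t x (M.xiStar C X) (M.etaStar C X) := by
  have hl0 : 0 < l := M.l₀_nonneg.trans_lt hl
  obtain ⟨C, hC, hCc, hCd⟩ := M.exists_isRiccatiSolution hl0
  refine ⟨C, ⟨hC, fun C' hC' => DarkPool.Market.IsRiccatiSolution.eqOn M hl0 hC hC'⟩,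
    fun t ht htT x => ?_⟩
  have : Fact (t < M.T) := ⟨htT⟩
  exact M.exists_closedLoop hCc hCd ht x
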